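/- Let $A=A_0\oplus A_1$ be a $\mathbb Z_2$-graded complex vector space with $\dim A_0=2$ and $\dim A_1=1$, and let $W=\Pi A$ be its parity reversion (the same space with $W_0=A_1$, $W_1=A_0$), so that $W$ has dimension $1|2$. An associative algebra structure on $A$ is a bilinear map $m:A\times A\to A$ with $m(A_i,A_j)\subseteq A_{i+j}$ and $m(m(a,b),c)=m(a,m(b,c))$ (no unit is required). Two such structures $m,m'$ are isomorphic if $g(m(a,b))=m'(g(a),g(b))$ for some grading-preserving $g\in GL(A)$. Let $T(W)=\bigoplus_{n\ge 0}W^{\otimes n}$ be the tensor coalgebra, with the deconcatenation coproduct. An odd quadratic codifferential is an odd coderivation $D$ of $T(W)$ with $[D,D]=2D^2=0$ whose components $W^{\otimes n}\to W$ vanish for $n\neq 2$. Two of them, $D$ and $D'$, are equivalent if $T(g)D=D'T(g)$ for some grading-preserving $g\in GL(W)$. Every bilinear map $d:W\times W\to W$ of odd degree extends to an odd quadratic coderivation of $T(W)$, denoted by the same letter, by $$d(w_1\cdots w_n)=\sum_{i=0}^{n-2}(-1)^{|w_1|+\cdots+|w_i|}\,w_1\cdots w_i\,d(w_{i+1},w_{i+2})\,w_{i+3}\cdots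 w_n .$$ (1) The assignment $m\mapsto d$, $d(a,b)=(-1)^{|a|_W}m(a,b)$, where $|a|_W$ is the parity of $a$ in $W$, is a bijection from the associative algebra structures on $A$ onto the odd quadratic codifferentials on $T(W)$. Two algebra structures are isomorphic if and only if the corresponding codifferentials are equivalent. (2) There is a basis $v_1,v_2,v_3$ of $W$ with $v_1$ even and $v_2,v_3$ odd. For every such basis, let $\psi_k^{ij}$ be the bilinear map with $(v_i,v_j)\mapsto v_k$ that vanishes on all other pairs of basis vectors, and let $$\begin{aligned} d_1&=\psi_1^{13}-\psi_1^{31}+\psi_3^{11}+\psi_2^{22}-\psi_3^{33}, & d_2&=\psi_1^{13}-\psi_1^{31}+\psi_3^{11}-\psi_3^{33},\\ d_3&=\psi_2^{22}+\psi_3^{33}-\psi_1^{12}, & d_4&=\psi_2^{22}+\psi_3^{33}+\psi_1^{21},\\ d_5&=\psi_2^{22}+\psi_3^{33}+\psi_1^{21}-\psi_1^{13}, & d_6&=\psi_2^{22}+\psi_3^{33}+\psi_1^{21}-\psi_1^{12},\\ d_7&=\psi_2^{22}+\psi_3^{33}, & d_8&=\psi_3^{33}+\psi_2^{11}+\psi_1^{31}-\psi_1^{13}+\psi_2^{32}+\psi_2^{23},\\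 d_9&=\psi_3^{33}+\psi_2^{11}, & d_{10}&=\psi_3^{33}-\psi_1^{13}+\psi_2^{23},\\ d_{11}&=\psi_3^{33}+\psi_1^{31}+\psi_2^{32}, & d_{12}&=\psi_3^{33}+\psi_1^{31}+\psi_2^{23},\\ d_{13}&=\psi_3^{33}-\psi_1^{13}+\psi_2^{32}, & d_{14}&=\psi_3^{33}+\psi_1^{31}-\psi_1^{13}+\psi_2^{23},\\ d_{15}&=\psi_3^{33}+\psi_1^{31}-\psi_1^{13}+\psi_2^{32}, & d_{16}&=\psi_3^{33}+\psi_2^{23},\\ d_{17}&=\psi_3^{33}+\psi_2^{32}, & d_{18}&=\psi_3^{33}-\psi_1^{13}+\psi_2^{23}+\psi_2^{32},\\ d_{19}&=\psi_3^{33}+\psi_1^{31}+\psi_2^{23}+\psi_2^{32}, & d_{20}&=\psi_3^{33}+\psi_2^{23}+\psi_2^{32},\\ d_{21}&=\psi_3^{33}-\psi_1^{13}, & d_{22}&=\psi_3^{33}+\psi_1^{31},\\ d_{23}&=\psi_3^{33}-\psi_1^{13}+\psi_1^{31}, & d_{24}&=\psi_3^{33}-\psi_1^{13}+\psi_1^{31}+\psi_2^{23}+\psi_2^{32},\\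 d_{25}&=\psi_3^{33}, & d_{26}&=\psi_2^{11}+\psi_2^{33},\\ d_{27}&=\psi_2^{11}, & d_{28}&=\psi_2^{33}. \end{aligned}$$ Then $d_1,\dots,d_{28}$ are nonzero odd quadratic codifferentials on $T(W)$, they are pairwise nonequivalent, and every nonzero odd quadratic codifferential on $T(W)$ is equivalent to one of them. Likewise, the algebra structures on $A$ that correspond to $d_1,\dots,d_{28}$ are nonzero and pairwise nonisomorphic, and every nonzero associative algebra structure on $A$ is isomorphic to one of them. -/

import Mathlib

open scoped TensorProduct

namespace SuperAlg

noncomputable section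

/-! ### `ℤ/2`-graded spaces

A `ℤ/2`-graded (super) space is a complex vector space `W` with two submodules `𝒲 0` (even part) and
`𝒲 1` (odd part) such that `W = 𝒲 0 ⊕ 𝒲 1`. -/

/-- The parity reversion `Π𝒜` of a grading: the same space, with even and odd part exchanged. -/
def parityRev {A : Type*} [AddCommGroup A] [Module ℂ A] (𝒜 : ZMod 2 → Submodule ℂ A) :
    ZMod 2 → Submodule ℂ A :=
  fun i => 𝒜 (i + 1)

theorem parityRev_isInternal {A : Type*} [AddCommGroup A] [Module ℂ A]
    (𝒜 : ZMod 2 → Submodule ℂ A) [DirectSum.Decomposition 𝒜] :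
    DirectSum.IsInternal (parityRev 𝒜) := by
  have h := DirectSum.Decomposition.isInternal 𝒜
  rw [DirectSum.isInternal_submodule_iff_iSupIndep_and_iSup_eq_top] at h ⊢
  refine ⟨h.1.comp (add_left_injective (1 : ZMod 2)), ?_⟩
  rw [← h.2]
  exact (Equiv.addRight (1 : ZMod 2)).iSup_comp (g := 𝒜)

instance parityRevDecomposition {A : Type*} [AddCommGroup A] [Module ℂ A]
    (𝒜 : ZMod 2 → Submodule ℂ A) [DirectSum.Decomposition 𝒜] :
    DirectSum.Decomposition (parityRev 𝒜) :=
  (parityRev_isInternal 𝒜).chooseDecomposition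

/-- The parity operator `ε` of a graded space: `ε w = (-1)^|w| w` for homogeneous `w`. -/
def parityOp {W : Type*} [AddCommGroup W] [Module ℂ W]
    (𝒲 : ZMod 2 → Submodule ℂ W) [DirectSum.Decomposition 𝒲] : W →ₗ[ℂ] W :=
  (𝒲 0).subtype ∘ₗ DirectSum.component ℂ (ZMod 2) (fun i => 𝒲 i) 0 ∘ₗ
      (DirectSum.decomposeLinearEquiv 𝒲).toLinearMap -
    (𝒲 1).subtype ∘ₗ DirectSum.component ℂ (ZMod 2) (fun i => 𝒲 i) 1 ∘ₗ
      (DirectSum.decomposeLinearEquiv 𝒲).toLinearMap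

theorem parityOp_even {W : Type*} [AddCommGroup W] [Module ℂ W]
    (𝒲 : ZMod 2 → Submodule ℂ W) [DirectSum.Decomposition 𝒲] {w : W} (hw : w ∈ 𝒲 0) :
    parityOp 𝒲 w = w := by
  have h1 := DirectSum.decompose_of_mem_same 𝒲 hw
  have h2 := DirectSum.decompose_of_mem_ne 𝒲 hw (show (0 : ZMod 2) ≠ 1 by decide)
  change ((DirectSum.decompose 𝒲 w 0 : 𝒲 0) : W) - ((DirectSum.decompose 𝒲 w 1 : 𝒲 1) : W) = _
  rw [h1, h2]
  simp

theorem parityOp_odd {W : Type*} [AddCommGroup W] [Module ℂ W]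
    (𝒲 : ZMod 2 → Submodule ℂ W) [DirectSum.Decomposition 𝒲] {w : W} (hw : w ∈ 𝒲 1) :
    parityOp 𝒲 w = -w := by
  have h1 := DirectSum.decompose_of_mem_same 𝒲 hw
  have h2 := DirectSum.decompose_of_mem_ne 𝒲 hw (show (1 : ZMod 2) ≠ 0 by decide)
  change ((DirectSum.decompose 𝒲 w 0 : 𝒲 0) : W) - ((DirectSum.decompose 𝒲 w 1 : 𝒲 1) : W) = _
  rw [h1, h2]
  simp

/-! ### Graded associative algebras -/

/-- `m` is a `ℤ/2`-graded associative (not necessarily unital) algebra structure on `A`. -/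
structure IsGradedAssoc {A : Type*} [AddCommGroup A] [Module ℂ A]
    (𝒜 : ZMod 2 → Submodule ℂ A) (m : A →ₗ[ℂ] A →ₗ[ℂ] A) : Prop where
  graded : ∀ i j : ZMod 2, ∀ a ∈ 𝒜 i, ∀ b ∈ 𝒜 j, m a b ∈ 𝒜 (i + j)
  assoc : ∀ a b c : A, m (m a b) c = m a (m b c)

/-- Isomorphism of algebra structures on `A`: a bijective linear map that preserves the grading
and intertwines the products. -/
def AlgIso {A : Type*} [AddCommGroup A] [Module ℂ A]
    (𝒜 : ZMod 2 → Submodule ℂ A) (m m' : A →ₗ[ℂ] A →ₗ[ℂ] A) : Prop :=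
  ∃ g : A ≃ₗ[ℂ] A, (∀ i : ZMod 2, ∀ a ∈ 𝒜 i, g a ∈ 𝒜 i) ∧
    ∀ a b : A, g (m a b) = m' (g a) (g b)

/-! ### The tensor coalgebra

The underlying space of the tensor coalgebra `T(W) = ⨁ Wⁿ` is `TensorAlgebra ℂ W`; the word
`w₁ ⋯ wₙ` is `ι w₁ * ⋯ * ι wₙ`. -/

/-- Auxiliary operator: left multiplication by the letter `w` on pairs `(x, Δ x)`. -/
def comulStep (W : Type*) [AddCommGroup W] [Module ℂ W] :
    W →ₗ[ℂ] Module.End ℂ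
      (TensorAlgebra ℂ W × (TensorAlgebra ℂ W ⊗[ℂ] TensorAlgebra ℂ W)) :=
  LinearMap.mk₂ ℂ
    (fun w p => (TensorAlgebra.ι ℂ w * p.1,
      (1 : TensorAlgebra ℂ W) ⊗ₜ[ℂ] (TensorAlgebra.ι ℂ w * p.1) +
        LinearMap.rTensor (TensorAlgebra ℂ W)
          (LinearMap.mul ℂ (TensorAlgebra ℂ W) (TensorAlgebra.ι ℂ w)) p.2))
    (by
      intro w w' p
      ext1
      · simp [add_mul]
      · simp only [map_add, add_mul, TensorProduct.tmul_add, LinearMap.rTensor_add,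
          LinearMap.add_apply, Prod.snd_add]
        abel)
    (by
      intro c w p
      ext1
      · simp
      · simp [LinearMap.rTensor_smul])
    (by
      intro w p p'
      ext1
      · simp [mul_add]
      · simp only [map_add, mul_add, TensorProduct.tmul_add, Prod.snd_add, Prod.fst_add]
        abel)
    (by
      intro c w p
      ext1
      · simp
      · simp)

/-- The deconcatenation coproduct
`Δ(w₁ ⋯ wₙ) = ∑ᵢ w₁ ⋯ wᵢ ⊗ wᵢ₊₁ ⋯ wₙ` (see `comul_word`). -/
def comul (W : Type*) [AddCommGroup W] [Module ℂ W] :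
    TensorAlgebra ℂ W →ₗ[ℂ] TensorAlgebra ℂ W ⊗[ℂ] TensorAlgebra ℂ W :=
  LinearMap.snd ℂ _ _ ∘ₗ
    LinearMap.applyₗ
      ((1 : TensorAlgebra ℂ W), (1 : TensorAlgebra ℂ W) ⊗ₜ[ℂ] (1 : TensorAlgebra ℂ W)) ∘ₗ
    (TensorAlgebra.lift ℂ (comulStep W)).toLinearMap

theorem lift_comulStep_fst {W : Type*} [AddCommGroup W] [Module ℂ W] (x : TensorAlgebra ℂ W)
    (p : TensorAlgebra ℂ W × (TensorAlgebra ℂ W ⊗[ℂ] TensorAlgebra ℂ W)) :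
    (TensorAlgebra.lift ℂ (comulStep W) x p).1 = x * p.1 := by
  induction x using TensorAlgebra.induction generalizing p with
  | algebraMap r => simp [Algebra.smul_def]
  | ι w => simp [comulStep]
  | mul a b ha hb => simp [ha, hb, mul_assoc]
  | add a b ha hb => simp [ha, hb, add_mul]

theorem comul_one {W : Type*} [AddCommGroup W] [Module ℂ W] :
    comul W 1 = (1 : TensorAlgebra ℂ W) ⊗ₜ[ℂ] (1 : TensorAlgebra ℂ W) := by
  simp [comul]

theorem comul_ι_mul {W : Type*} [AddCommGroup W] [Module ℂ W] (w : W) (x : TensorAlgebra ℂ W) :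
    comul W (TensorAlgebra.ι ℂ w * x) =
      (1 : TensorAlgebra ℂ W) ⊗ₜ[ℂ] (TensorAlgebra.ι ℂ w * x) +
        LinearMap.rTensor (TensorAlgebra ℂ W)
          (LinearMap.mul ℂ (TensorAlgebra ℂ W) (TensorAlgebra.ι ℂ w)) (comul W x) := by
  have h := lift_comulStep_fst x
    ((1 : TensorAlgebra ℂ W), (1 : TensorAlgebra ℂ W) ⊗ₜ[ℂ] (1 : TensorAlgebra ℂ W))
  simp only [mul_one] at h
  simp [comul, comulStep] at h ⊢
  rw [h]

theorem comul_word {W : Type*} [AddCommGroup W] [Module ℂ W] (l : List W) :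
    comul W (l.map (TensorAlgebra.ι ℂ)).prod =
      ∑ i ∈ Finset.range (l.length + 1),
        ((l.take i).map (TensorAlgebra.ι ℂ)).prod ⊗ₜ[ℂ]
          ((l.drop i).map (TensorAlgebra.ι ℂ)).prod := by
  induction l with
  | nil => simp [comul_one]
  | cons w l ih =>
    rw [List.map_cons, List.prod_cons, comul_ι_mul, ih, List.length_cons,
      Finset.sum_range_succ' _ (l.length + 1)]
    simp [map_sum, add_comm]

/-- The map `T(f) : T(W) → T(W)`, `w₁ ⋯ wₙ ↦ f(w₁) ⋯ f(wₙ)`. -/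
def tensorMap {W : Type*} [AddCommGroup W] [Module ℂ W] (f : W →ₗ[ℂ] W) :
    TensorAlgebra ℂ W →ₗ[ℂ] TensorAlgebra ℂ W :=
  (TensorAlgebra.lift ℂ (TensorAlgebra.ι ℂ ∘ₗ f)).toLinearMap

theorem tensorMap_word {W : Type*} [AddCommGroup W] [Module ℂ W] (f : W →ₗ[ℂ] W) (l : List W) :
    tensorMap f (l.map (TensorAlgebra.ι ℂ)).prod =
      ((l.map f).map (TensorAlgebra.ι ℂ)).prod := by
  simp [tensorMap, map_list_prod, Function.comp_def]

/-- The parity operator of `T(W)`: `w₁ ⋯ wₙ ↦ (-1)^(|w₁| + ⋯ + |wₙ|) w₁ ⋯ wₙ`. -/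
def tensorParity {W : Type*} [AddCommGroup W] [Module ℂ W]
    (𝒲 : ZMod 2 → Submodule ℂ W) [DirectSum.Decomposition 𝒲] :
    TensorAlgebra ℂ W →ₗ[ℂ] TensorAlgebra ℂ W :=
  tensorMap (parityOp 𝒲)

/-- `D` is an odd quadratic codifferential on `T(W)`. -/
structure IsQuadCodiff {W : Type*} [AddCommGroup W] [Module ℂ W]
    (𝒲 : ZMod 2 → Submodule ℂ W) [DirectSum.Decomposition 𝒲]
    (D : TensorAlgebra ℂ W →ₗ[ℂ] TensorAlgebra ℂ W) : Prop where
  /-- `D` is an odd map: it reverses the parity of homogeneous elements of `T(W)`. -/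
  odd : D ∘ₗ tensorParity 𝒲 = -(tensorParity 𝒲 ∘ₗ D)
  /-- `D` is a coderivation, `Δ ∘ D = (D ⊗ 1 + 1 ⊗ D) ∘ Δ` with the sign rule
  `(1 ⊗ D) (x ⊗ y) = (-1)^|x| x ⊗ D y` for the odd map `D`. -/
  coderivation : comul W ∘ₗ D =
    (TensorProduct.map D LinearMap.id + TensorProduct.map (tensorParity 𝒲) D) ∘ₗ comul W
  /-- `D` is quadratic: its component `Wⁿ → W` vanishes unless `n = 2`. -/
  quadratic : ∀ n : ℕ, n ≠ 2 → ∀ x ∈ LinearMap.range (TensorAlgebra.ι ℂ (M := W)) ^ n,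
    TensorAlgebra.ιInv (D x) = 0
  /-- `[D, D] = 2 D ∘ D` vanishes. -/
  sq_zero : D ∘ₗ D = 0

/-- Equivalence of codifferentials: they are intertwined by the automorphism of `T(W)` that
comes from an even linear automorphism `g` of `W`. -/
def CodiffEquiv {W : Type*} [AddCommGroup W] [Module ℂ W]
    (𝒲 : ZMod 2 → Submodule ℂ W)
    (D D' : TensorAlgebra ℂ W →ₗ[ℂ] TensorAlgebra ℂ W) : Prop :=
  ∃ g : W ≃ₗ[ℂ] W, (∀ i : ZMod 2, ∀ w ∈ 𝒲 i, g w ∈ 𝒲 i) ∧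
    tensorMap g.toLinearMap ∘ₗ D = D' ∘ₗ tensorMap g.toLinearMap

/-! ### From bilinear maps to coderivations -/

/-- Auxiliary operator: left multiplication by the letter `w` on triples
`(x, (u ↦ d(u, x₁) x₂ ⋯ xₙ), D x)`, where `x = x₁ ⋯ xₙ`. -/
def coderStep {W : Type*} [AddCommGroup W] [Module ℂ W]
    (𝒲 : ZMod 2 → Submodule ℂ W) [DirectSum.Decomposition 𝒲] (d : W →ₗ[ℂ] W →ₗ[ℂ] W) :
    W →ₗ[ℂ] Module.End ℂ
      (TensorAlgebra ℂ W × (W →ₗ[ℂ] TensorAlgebra ℂ W) × TensorAlgebra ℂ W) :=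
  LinearMap.mk₂ ℂ
    (fun w p => (TensorAlgebra.ι ℂ w * p.1,
      (LinearMap.mul ℂ (TensorAlgebra ℂ W)).flip p.1 ∘ₗ TensorAlgebra.ι ℂ ∘ₗ d.flip w,
      p.2.1 w + TensorAlgebra.ι ℂ (parityOp 𝒲 w) * p.2.2))
    (by
      intro w w' p
      refine Prod.ext ?_ (Prod.ext ?_ ?_)
      · simp [add_mul]
      · ext u; simp
      · simp only [map_add, add_mul, Prod.snd_add]
        abel)
    (by
      intro c w p
      refine Prod.ext ?_ (Prod.ext ?_ ?_)
      · simp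
      · ext u; simp
      · simp)
    (by
      intro w p p'
      refine Prod.ext ?_ (Prod.ext ?_ ?_)
      · simp [mul_add]
      · ext u; simp
      · simp only [LinearMap.add_apply, mul_add, Prod.snd_add, Prod.fst_add]
        abel)
    (by
      intro c w p
      refine Prod.ext ?_ (Prod.ext ?_ ?_)
      · simp
      · ext u; simp
      · simp)

/-- The extension of a bilinear map `d : W ⊗ W → W` to `T(W)` as an odd coderivation,
`w₁ ⋯ wₙ ↦ ∑ᵢ (-1)^(|w₁| + ⋯ + |wᵢ|) w₁ ⋯ wᵢ d(wᵢ₊₁, wᵢ₊₂) wᵢ₊₃ ⋯ wₙ` (see `coder_one`,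
`coder_ι`, `coder_ι_mul_ι_mul`). -/
def coder {W : Type*} [AddCommGroup W] [Module ℂ W]
    (𝒲 : ZMod 2 → Submodule ℂ W) [DirectSum.Decomposition 𝒲] (d : W →ₗ[ℂ] W →ₗ[ℂ] W) :
    TensorAlgebra ℂ W →ₗ[ℂ] TensorAlgebra ℂ W :=
  LinearMap.snd ℂ _ _ ∘ₗ LinearMap.snd ℂ _ _ ∘ₗ
    LinearMap.applyₗ ((1 : TensorAlgebra ℂ W), ((0 : W →ₗ[ℂ] TensorAlgebra ℂ W), 0)) ∘ₗ
    (TensorAlgebra.lift ℂ (coderStep 𝒲 d)).toLinearMap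

theorem lift_coderStep_fst {W : Type*} [AddCommGroup W] [Module ℂ W]
    (𝒲 : ZMod 2 → Submodule ℂ W) [DirectSum.Decomposition 𝒲] (d : W →ₗ[ℂ] W →ₗ[ℂ] W)
    (x : TensorAlgebra ℂ W)
    (p : TensorAlgebra ℂ W × (W →ₗ[ℂ] TensorAlgebra ℂ W) × TensorAlgebra ℂ W) :
    (TensorAlgebra.lift ℂ (coderStep 𝒲 d) x p).1 = x * p.1 := by
  induction x using TensorAlgebra.induction generalizing p with
  | algebraMap r => simp [Algebra.smul_def]
  | ι w => simp [coderStep]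
  | mul a b ha hb => simp [ha, hb, mul_assoc]
  | add a b ha hb => simp [ha, hb, add_mul]

theorem coder_one {W : Type*} [AddCommGroup W] [Module ℂ W]
    (𝒲 : ZMod 2 → Submodule ℂ W) [DirectSum.Decomposition 𝒲] (d : W →ₗ[ℂ] W →ₗ[ℂ] W) :
    coder 𝒲 d 1 = 0 := by
  simp [coder]

theorem coder_ι {W : Type*} [AddCommGroup W] [Module ℂ W]
    (𝒲 : ZMod 2 → Submodule ℂ W) [DirectSum.Decomposition 𝒲] (d : W →ₗ[ℂ] W →ₗ[ℂ] W) (a : W) :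
    coder 𝒲 d (TensorAlgebra.ι ℂ a) = 0 := by
  simp [coder, coderStep]

theorem coder_ι_mul_ι_mul {W : Type*} [AddCommGroup W] [Module ℂ W]
    (𝒲 : ZMod 2 → Submodule ℂ W) [DirectSum.Decomposition 𝒲] (d : W →ₗ[ℂ] W →ₗ[ℂ] W)
    (a b : W) (x : TensorAlgebra ℂ W) :
    coder 𝒲 d (TensorAlgebra.ι ℂ a * (TensorAlgebra.ι ℂ b * x)) =
      TensorAlgebra.ι ℂ (d a b) * x +
        TensorAlgebra.ι ℂ (parityOp 𝒲 a) * coder 𝒲 d (TensorAlgebra.ι ℂ b * x) := by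
  have h := lift_coderStep_fst 𝒲 d x ((1 : TensorAlgebra ℂ W), ((0 : W →ₗ[ℂ] TensorAlgebra ℂ W), 0))
  simp only [mul_one] at h
  simp [coder, coderStep] at h ⊢
  exact Or.inl h

/-- The shift between bilinear maps on `A` and on `ΠA`: with `π : A → ΠA` the (odd) identity map,
`m` and `d` correspond when `d = π ∘ m ∘ (π⁻¹ ⊗ π⁻¹)`, that is,
`d (π a) (π b) = (-1)^|π a| π (m a b)`. The shift is its own inverse. -/
def shift {A : Type*} [AddCommGroup A] [Module ℂ A]
    (𝒜 : ZMod 2 → Submodule ℂ A) [DirectSum.Decomposition 𝒜] (m : A →ₗ[ℂ] A →ₗ[ℂ] A) :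
    A →ₗ[ℂ] A →ₗ[ℂ] A :=
  m ∘ₗ parityOp (parityRev 𝒜)

/-- The coderivation of `T(ΠA)` that corresponds to the product `m` on `A`. -/
def codiffOfAlg {A : Type*} [AddCommGroup A] [Module ℂ A]
    (𝒜 : ZMod 2 → Submodule ℂ A) [DirectSum.Decomposition 𝒜] (m : A →ₗ[ℂ] A →ₗ[ℂ] A) :
    TensorAlgebra ℂ A →ₗ[ℂ] TensorAlgebra ℂ A :=
  coder (parityRev 𝒜) (shift 𝒜 m)

/-! ### The 28 structures -/

/-- A basis `(v₁, v₂, v₃) = (v 0, v 1, v 2)` with `v₁` even and `v₂`, `v₃` odd. -/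
def IsAdapted {W : Type*} [AddCommGroup W] [Module ℂ W]
    (𝒲 : ZMod 2 → Submodule ℂ W) (v : Module.Basis (Fin 3) ℂ W) : Prop :=
  v 0 ∈ 𝒲 0 ∧ v 1 ∈ 𝒲 1 ∧ v 2 ∈ 𝒲 1

/-- The bilinear map with `(v i, v j) ↦ v k` that vanishes on all other pairs of basis vectors. -/
def elem {W : Type*} [AddCommGroup W] [Module ℂ W] (v : Module.Basis (Fin 3) ℂ W)
    (i j k : Fin 3) : W →ₗ[ℂ] W →ₗ[ℂ] W :=
  LinearMap.mk₂ ℂ (fun a b => (v.coord i a * v.coord j b) • v k)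
    (by intro a a' b; simp [add_mul, add_smul])
    (by intro c a b; simp [mul_assoc, mul_smul])
    (by intro a b b'; simp [mul_add, add_smul])
    (by intro c a b; simp [mul_left_comm, mul_smul])

theorem elem_basis {W : Type*} [AddCommGroup W] [Module ℂ W] (v : Module.Basis (Fin 3) ℂ W)
    (i j k p q : Fin 3) :
    elem v i j k (v p) (v q) = if p = i ∧ q = j then v k else 0 := by
  simp only [elem, LinearMap.mk₂_apply, Module.Basis.coord_apply, Module.Basis.repr_self,
    Finsupp.single_apply]
  by_cases h1 : p = i <;> by_cases h2 : q = j <;> simp [h1, h2]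

/-- The bilinear maps `d₁, …, d₂₈` (in this order), where `ψ i j k : (vᵢ, vⱼ) ↦ vₖ`
and basis vectors are numbered `1, 2, 3`; the literal `3` denotes the third basis vector. -/
def dTable {W : Type*} [AddCommGroup W] [Module ℂ W] (v : Module.Basis (Fin 3) ℂ W) :
    Fin 28 → (W →ₗ[ℂ] W →ₗ[ℂ] W) :=
  let ψ : Fin 3 → Fin 3 → Fin 3 → (W →ₗ[ℂ] W →ₗ[ℂ] W) :=
    fun i j k => elem v (i - 1) (j - 1) (k - 1)
  ![ψ 1 3 1 - ψ 3 1 1 + ψ 1 1 3 + ψ 2 2 2 - ψ 3 3 3,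
    ψ 1 3 1 - ψ 3 1 1 + ψ 1 1 3 - ψ 3 3 3,
    ψ 2 2 2 + ψ 3 3 3 - ψ 1 2 1,
    ψ 2 2 2 + ψ 3 3 3 + ψ 2 1 1,
    ψ 2 2 2 + ψ 3 3 3 + ψ 2 1 1 - ψ 1 3 1,
    ψ 2 2 2 + ψ 3 3 3 + ψ 2 1 1 - ψ 1 2 1,
    ψ 2 2 2 + ψ 3 3 3,
    ψ 3 3 3 + ψ 1 1 2 + ψ 3 1 1 - ψ 1 3 1 + ψ 3 2 2 + ψ 2 3 2,
    ψ 3 3 3 + ψ 1 1 2,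
    ψ 3 3 3 - ψ 1 3 1 + ψ 2 3 2,
    ψ 3 3 3 + ψ 3 1 1 + ψ 3 2 2,
    ψ 3 3 3 + ψ 3 1 1 + ψ 2 3 2,
    ψ 3 3 3 - ψ 1 3 1 + ψ 3 2 2,
    ψ 3 3 3 + ψ 3 1 1 - ψ 1 3 1 + ψ 2 3 2,
    ψ 3 3 3 + ψ 3 1 1 - ψ 1 3 1 + ψ 3 2 2,
    ψ 3 3 3 + ψ 2 3 2,
    ψ 3 3 3 + ψ 3 2 2,
    ψ 3 3 3 - ψ 1 3 1 + ψ 2 3 2 + ψ 3 2 2,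
    ψ 3 3 3 + ψ 3 1 1 + ψ 2 3 2 + ψ 3 2 2,
    ψ 3 3 3 + ψ 2 3 2 + ψ 3 2 2,
    ψ 3 3 3 - ψ 1 3 1,
    ψ 3 3 3 + ψ 3 1 1,
    ψ 3 3 3 - ψ 1 3 1 + ψ 3 1 1,
    ψ 3 3 3 - ψ 1 3 1 + ψ 3 1 1 + ψ 2 3 2 + ψ 3 2 2,
    ψ 3 3 3,
    ψ 1 1 2 + ψ 3 3 2,
    ψ 1 1 2,
    ψ 3 3 2]

end

end SuperAlg

namespace SuperAlg

/-! A coderivation of the tensor coalgebra is determined by its component in `W`. Hence an odd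
quadratic one is `coder 𝒲 d` for an odd bilinear map d (`coderivation_eq_zero`,
`IsQuadCodiff.exists_eq_coder`). Its square vanishes exactly when d(d(a,b),c) + d(εa,d(b,c)) = 0,
where ε is the parity operator (`coder_comp_coder_eq_zero_iff`). The twist d(a,b) = m(εa,b) turns
this identity into associativity of m. Grading-preserving automorphisms commute with ε, so the two
notions of equivalence agree (`algIso_iff_codiffEquiv`), and the classification can be carried out
for algebras.

Existence rests on the two-dimensional algebra A₀. If it contains a nonzero idempotent u, the Peirce
decomposition for u gives ℂ × ℂ, ℂ plus a null line, the dual numbers, or an algebra with a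
one-sided unit only (`exists_realizes_of_idempotent`). Otherwise it is spanned by x and x² with x³ =
0, or has zero product. The odd part is a line ℂe, so A₀ acts on it from each side by a
multiplicative functional, possibly zero. The product ee lies in A₀, and associativity leaves few
choices for it (`IsGradedAssoc.exists_scalars`). Rescaling basis vectors normalises what remains,
and each case matches one table.

The tables have integer structure constants, so associativity and nonvanishing are finite
computations. Nonisomorphism follows from ten invariant properties whose truth values differ for any
two tables (`invariantConst_injective`). -/

theorem eq_zero_of_eq_neg_self {W : Type*} [AddCommGroup W] [Module ℂ W] {w : W}
    (h : w = -w) : w = 0 := by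
  have h2 : (2 : ℂ) • w = 0 := by
    rw [two_smul]
    exact add_eq_zero_iff_eq_neg.2 h
  exact (smul_eq_zero.1 h2).resolve_left two_ne_zero

/-! ### The grading expressed through the parity operator. -/

section Parity

variable {W : Type*} [AddCommGroup W] [Module ℂ W]
  (𝒲 : ZMod 2 → Submodule ℂ W) [DirectSum.Decomposition 𝒲]

theorem exists_even_add_odd (w : W) : ∃ a ∈ 𝒲 0, ∃ b ∈ 𝒲 1, a + b = w := by
  induction w using DirectSum.Decomposition.inductionOn 𝒲 with
  | zero => exact ⟨0, zero_mem _, 0, zero_mem _, by simp⟩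
  | @homogeneous i m =>
    obtain ⟨m, hm⟩ := m
    fin_cases i
    · exact ⟨m, hm, 0, zero_mem _, by simp⟩
    · exact ⟨0, zero_mem _, m, hm, by simp⟩
  | add x y hx hy =>
    obtain ⟨a, ha, b, hb, rfl⟩ := hx
    obtain ⟨a', ha', b', hb', rfl⟩ := hy
    exact ⟨a + a', add_mem ha ha', b + b', add_mem hb hb', by abel⟩

@[simp] theorem parityOp_parityOp (w : W) : parityOp 𝒲 (parityOp 𝒲 w) = w := by
  obtain ⟨a, ha, b, hb, rfl⟩ := exists_even_add_odd 𝒲 w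
  simp [parityOp_even 𝒲 ha, parityOp_odd 𝒲 hb]

theorem mem_even_iff {w : W} : w ∈ 𝒲 0 ↔ parityOp 𝒲 w = w := by
  refine ⟨parityOp_even 𝒲, fun h => ?_⟩
  obtain ⟨a, ha, b, hb, rfl⟩ := exists_even_add_odd 𝒲 w
  have hb0 : b = 0 := by
    rw [map_add, parityOp_even 𝒲 ha, parityOp_odd 𝒲 hb] at h
    exact eq_zero_of_eq_neg_self (add_left_cancel h).symm
  simpa [hb0] using ha

theorem mem_odd_iff {w : W} : w ∈ 𝒲 1 ↔ parityOp 𝒲 w = -w := by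
  refine ⟨parityOp_odd 𝒲, fun h => ?_⟩
  obtain ⟨a, ha, b, hb, rfl⟩ := exists_even_add_odd 𝒲 w
  have ha0 : a = 0 := by
    rw [map_add, parityOp_even 𝒲 ha, parityOp_odd 𝒲 hb, neg_add] at h
    exact eq_zero_of_eq_neg_self (add_right_cancel h)
  simpa [ha0] using hb

/-- Even and odd vectors are the eigenvectors of ε for 1 and -1, so a map respects both parts
exactly when it commutes with ε. This replaces case distinctions on parity by identities that hold
for all vectors. -/
theorem preserves_grading_iff (g : W →ₗ[ℂ] W) :
    (∀ i : ZMod 2, ∀ w ∈ 𝒲 i, g w ∈ 𝒲 i) ↔ ∀ w, g (parityOp 𝒲 w) = parityOp 𝒲 (g w) := by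
  constructor
  · intro h w
    obtain ⟨a, ha, b, hb, rfl⟩ := exists_even_add_odd 𝒲 w
    simp [parityOp_even 𝒲 ha, parityOp_odd 𝒲 hb, parityOp_even 𝒲 (h 0 a ha),
      parityOp_odd 𝒲 (h 1 b hb)]
  · intro h i w hw
    fin_cases i
    · exact (mem_even_iff 𝒲).2 (by rw [← h, parityOp_even 𝒲 hw])
    · exact (mem_odd_iff 𝒲).2 (by rw [← h, parityOp_odd 𝒲 hw, map_neg])

/-- A bilinear map is odd if it sends a pair of homogeneous elements of total parity `p`
to an element of parity `p + 1`. -/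
def IsOddBilin (d : W →ₗ[ℂ] W →ₗ[ℂ] W) : Prop :=
  ∀ a b, parityOp 𝒲 (d a b) = -d (parityOp 𝒲 a) (parityOp 𝒲 b)

end Parity

/-! ### Parity reversion and the sign twist. -/

section Shift

variable {A : Type*} [AddCommGroup A] [Module ℂ A]
  (𝒜 : ZMod 2 → Submodule ℂ A) [DirectSum.Decomposition 𝒜]

@[simp] theorem shift_apply (m : A →ₗ[ℂ] A →ₗ[ℂ] A) (a b : A) :
    shift 𝒜 m a b = m (parityOp (parityRev 𝒜) a) b := rfl

@[simp] theorem shift_shift (m : A →ₗ[ℂ] A →ₗ[ℂ] A) : shift 𝒜 (shift 𝒜 m) = m := by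
  ext a b
  simp

theorem mem_zero_iff {a : A} : a ∈ 𝒜 0 ↔ parityOp (parityRev 𝒜) a = -a :=
  mem_odd_iff (parityRev 𝒜)

theorem mem_one_iff {a : A} : a ∈ 𝒜 1 ↔ parityOp (parityRev 𝒜) a = a :=
  mem_even_iff (parityRev 𝒜)

/-- The parity operator of ΠA is the negative of that of A. Three such signs enter the identity, one
from the value and two from the arguments, so evenness on A becomes oddness on ΠA. -/
theorem graded_iff (m : A →ₗ[ℂ] A →ₗ[ℂ] A) :
    (∀ i j : ZMod 2, ∀ a ∈ 𝒜 i, ∀ b ∈ 𝒜 j, m a b ∈ 𝒜 (i + j)) ↔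
      IsOddBilin (parityRev 𝒜) m := by
  constructor
  · intro h a b
    obtain ⟨a₀, ha₀, a₁, ha₁, rfl⟩ := exists_even_add_odd 𝒜 a
    obtain ⟨b₀, hb₀, b₁, hb₁, rfl⟩ := exists_even_add_odd 𝒜 b
    have h₀₀ := (mem_zero_iff 𝒜).1 (h 0 0 a₀ ha₀ b₀ hb₀)
    have h₀₁ := (mem_one_iff 𝒜).1 (h 0 1 a₀ ha₀ b₁ hb₁)
    have h₁₀ := (mem_one_iff 𝒜).1 (h 1 0 a₁ ha₁ b₀ hb₀)
    have h₁₁ := (mem_zero_iff 𝒜).1 (h 1 1 a₁ ha₁ b₁ hb₁)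
    rw [mem_zero_iff 𝒜] at ha₀ hb₀
    rw [mem_one_iff 𝒜] at ha₁ hb₁
    simp only [map_add, LinearMap.add_apply, ha₀, ha₁, hb₀, hb₁, h₀₀, h₀₁, h₁₀, h₁₁, map_neg,
      LinearMap.neg_apply]
    abel
  · intro h i j a ha b hb
    have hab := h a b
    fin_cases i <;> fin_cases j
    · rw [(mem_zero_iff 𝒜).1 ha, (mem_zero_iff 𝒜).1 hb] at hab
      exact (mem_zero_iff 𝒜).2 (by simpa using hab)
    · rw [(mem_zero_iff 𝒜).1 ha, (mem_one_iff 𝒜).1 hb] at hab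
      exact (mem_one_iff 𝒜).2 (by simpa using hab)
    · rw [(mem_one_iff 𝒜).1 ha, (mem_zero_iff 𝒜).1 hb] at hab
      exact (mem_one_iff 𝒜).2 (by simpa using hab)
    · rw [(mem_one_iff 𝒜).1 ha, (mem_one_iff 𝒜).1 hb] at hab
      exact (mem_zero_iff 𝒜).2 hab

theorem IsOddBilin.shift {m : A →ₗ[ℂ] A →ₗ[ℂ] A} (h : IsOddBilin (parityRev 𝒜) m) :
    IsOddBilin (parityRev 𝒜) (shift 𝒜 m) := fun a b => by simp [h _ b]

end Shift

/-! ### Induction on words and projections of the tensor algebra. -/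

section Tensor

open TensorAlgebra

variable {W : Type*} [AddCommGroup W] [Module ℂ W]

/-- Words are built by adding letters on the left. The elements x for which left multiplication by x
preserves `p` are closed under sums and products and contain scalars and letters, hence are all
elements. -/
theorem tensor_induction {p : TensorAlgebra ℂ W → Prop} (one : p 1)
    (smul : ∀ (c : ℂ) x, p x → p (c • x)) (add : ∀ x y, p x → p y → p (x + y))
    (ι_mul : ∀ w x, p x → p (ι ℂ w * x)) (x : TensorAlgebra ℂ W) : p x := by
  have key : ∀ x y : TensorAlgebra ℂ W, p y → p (x * y) := by
    intro x
    induction x using TensorAlgebra.induction with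
    | algebraMap r => intro y hy; rw [← Algebra.smul_def]; exact smul r y hy
    | ι w => exact fun y hy => ι_mul w y hy
    | mul a b ha hb => intro y hy; rw [mul_assoc]; exact ha _ (hb y hy)
    | add a b ha hb => intro y hy; rw [add_mul]; exact add _ _ (ha y hy) (hb y hy)
  simpa using key x 1 one

theorem tensor_hom_ext {M : Type*} [AddCommGroup M] [Module ℂ M]
    {f g : TensorAlgebra ℂ W →ₗ[ℂ] M} (one : f 1 = g 1)
    (ι_mul : ∀ w x, f x = g x → f (ι ℂ w * x) = g (ι ℂ w * x)) : f = g := by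
  ext x
  induction x using tensor_induction with
  | one => exact one
  | smul c x hx => simp [hx]
  | add x y hx hy => simp [hx, hy]
  | ι_mul w x hx => exact ι_mul w x hx

/-- The recursion for `coder` consumes two letters at once, so the induction carries the claim for x
together with the claim for every word w x. -/
theorem tensor_hom_ext₂ {M : Type*} [AddCommGroup M] [Module ℂ M]
    {f g : TensorAlgebra ℂ W →ₗ[ℂ] M} (one : f 1 = g 1) (ι : ∀ w, f (ι ℂ w) = g (ι ℂ w))
    (ι_mul_ι_mul : ∀ a b x, f (TensorAlgebra.ι ℂ b * x) = g (TensorAlgebra.ι ℂ b * x) →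
      f (TensorAlgebra.ι ℂ a * (TensorAlgebra.ι ℂ b * x)) =
        g (TensorAlgebra.ι ℂ a * (TensorAlgebra.ι ℂ b * x))) : f = g := by
  have key : ∀ x, f x = g x ∧
      ∀ w, f (TensorAlgebra.ι ℂ w * x) = g (TensorAlgebra.ι ℂ w * x) := by
    intro x
    induction x using tensor_induction with
    | one => exact ⟨one, fun w => by simpa using ι w⟩
    | smul c x hx => exact ⟨by simp [hx.1], fun w => by simp [hx.2 w]⟩
    | add x y hx hy => exact ⟨by simp [hx.1, hy.1], fun w => by simp [mul_add, hx.2 w, hy.2 w]⟩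
    | ι_mul w x hx => exact ⟨hx.2 w, fun a => ι_mul_ι_mul a w x (hx.2 w)⟩
  exact LinearMap.ext fun x => (key x).1

@[simp] theorem ιInv_one : ιInv (1 : TensorAlgebra ℂ W) = 0 := by
  -- `ιInv` is defined through the trivial square-zero extension, which needs a right action of ℂ on
  -- `W`; the local instances reproduce the one used there.
  let _ : Module ℂᵐᵒᵖ W := Module.compHom _ ((RingHom.id ℂ).fromOpposite mul_comm)
  have _ : IsCentralScalar ℂ W := ⟨fun r m => rfl⟩
  simp [ιInv]

@[simp] theorem ιInv_ι_mul (w : W) (x : TensorAlgebra ℂ W) :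
    ιInv (ι ℂ w * x) = algebraMapInv x • w := by
  let _ : Module ℂᵐᵒᵖ W := Module.compHom _ ((RingHom.id ℂ).fromOpposite mul_comm)
  have _ : IsCentralScalar ℂ W := ⟨fun r m => rfl⟩
  have h : ∀ x : TensorAlgebra ℂ W, (toTrivSqZeroExt x).fst = algebraMapInv x := by
    intro x
    induction x using TensorAlgebra.induction with
    | algebraMap r => simp [TrivSqZeroExt.algebraMap_eq_inl]
    | ι w => simp [algebraMapInv]
    | mul a b ha hb => simp [ha, hb]
    | add a b ha hb => simp [ha, hb]
  simp [ιInv, h]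

@[simp] theorem algebraMapInv_ι_mul (w : W) (x : TensorAlgebra ℂ W) :
    algebraMapInv (ι ℂ w * x) = 0 := by
  simp [algebraMapInv]

@[simp] theorem ιInv_ι (w : W) : ιInv (ι ℂ w) = w := ι_leftInverse w

@[simp] theorem tensorMap_one (f : W →ₗ[ℂ] W) : tensorMap f 1 = 1 := by simp [tensorMap]

@[simp] theorem tensorMap_mul (f : W →ₗ[ℂ] W) (x y : TensorAlgebra ℂ W) :
    tensorMap f (x * y) = tensorMap f x * tensorMap f y := by simp [tensorMap]

@[simp] theorem tensorMap_ι (f : W →ₗ[ℂ] W) (w : W) : tensorMap f (ι ℂ w) = ι ℂ (f w) := by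
  simp [tensorMap]

end Tensor

/-! ### Quadratic codifferentials as extensions of bilinear maps. -/

section Coder

open TensorAlgebra

variable {W : Type*} [AddCommGroup W] [Module ℂ W]
  (𝒲 : ZMod 2 → Submodule ℂ W) [DirectSum.Decomposition 𝒲]

@[simp] theorem tensorParity_one : tensorParity 𝒲 1 = 1 := tensorMap_one _

@[simp] theorem tensorParity_ι_mul (w : W) (x : TensorAlgebra ℂ W) :
    tensorParity 𝒲 (ι ℂ w * x) = ι ℂ (parityOp 𝒲 w) * tensorParity 𝒲 x := by
  simp [tensorParity]

@[simp] theorem tensorParity_ι (w : W) :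
    tensorParity 𝒲 (ι ℂ w) = ι ℂ (parityOp 𝒲 w) := tensorMap_ι _ _

theorem coder_ι_mul_ι (d : W →ₗ[ℂ] W →ₗ[ℂ] W) (a b : W) :
    coder 𝒲 d (ι ℂ a * ι ℂ b) = ι ℂ (d a b) := by
  simpa [coder_ι] using coder_ι_mul_ι_mul 𝒲 d a b 1

theorem coder_injective : Function.Injective (coder 𝒲) := by
  intro d d' h
  ext a b
  apply (ι_leftInverse (R := ℂ) (M := W)).injective
  rw [← coder_ι_mul_ι 𝒲 d, h, coder_ι_mul_ι]

theorem coder_odd {d : W →ₗ[ℂ] W →ₗ[ℂ] W} (hd : IsOddBilin 𝒲 d) :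
    coder 𝒲 d ∘ₗ tensorParity 𝒲 = -(tensorParity 𝒲 ∘ₗ coder 𝒲 d) := by
  apply tensor_hom_ext₂
  · simp [coder_one]
  · simp [coder_ι]
  · intro a b x h
    simp only [LinearMap.comp_apply, LinearMap.neg_apply, tensorParity_ι_mul] at h ⊢
    simp [coder_ι_mul_ι_mul, h, hd a b, add_comm]

/-- The coproduct satisfies Δ(wx) = 1 ⊗ wx + (w·)Δx, with w acting on the left factor. The
identities `hP` and `hD` move such letters past the two summands of the coderivation rule, after
which induction on words applies. -/
theorem coder_coderivation (d : W →ₗ[ℂ] W →ₗ[ℂ] W) :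
    comul W ∘ₗ coder 𝒲 d =
      (TensorProduct.map (coder 𝒲 d) LinearMap.id +
        TensorProduct.map (tensorParity 𝒲) (coder 𝒲 d)) ∘ₗ comul W := by
  have hP : ∀ (w : W) (t : TensorAlgebra ℂ W ⊗[ℂ] TensorAlgebra ℂ W),
      TensorProduct.map (tensorParity 𝒲) (coder 𝒲 d)
          (LinearMap.rTensor _ (LinearMap.mul ℂ (TensorAlgebra ℂ W) (ι ℂ w)) t) =
        LinearMap.rTensor _ (LinearMap.mul ℂ (TensorAlgebra ℂ W) (ι ℂ (parityOp 𝒲 w)))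
          (TensorProduct.map (tensorParity 𝒲) (coder 𝒲 d) t) := by
    intro w t
    induction t with
    | zero => simp
    | add x y hx hy => simp [hx, hy]
    | tmul x y => simp
  have hD : ∀ (a b : W) (t : TensorAlgebra ℂ W ⊗[ℂ] TensorAlgebra ℂ W),
      TensorProduct.map (coder 𝒲 d) LinearMap.id
          (LinearMap.rTensor _ (LinearMap.mul ℂ (TensorAlgebra ℂ W) (ι ℂ a))
            (LinearMap.rTensor _ (LinearMap.mul ℂ (TensorAlgebra ℂ W) (ι ℂ b)) t)) =
        LinearMap.rTensor _ (LinearMap.mul ℂ (TensorAlgebra ℂ W) (ι ℂ (d a b))) t +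
        LinearMap.rTensor _ (LinearMap.mul ℂ (TensorAlgebra ℂ W) (ι ℂ (parityOp 𝒲 a)))
          (TensorProduct.map (coder 𝒲 d) LinearMap.id
            (LinearMap.rTensor _ (LinearMap.mul ℂ (TensorAlgebra ℂ W) (ι ℂ b)) t)) := by
    intro a b t
    induction t with
    | zero => simp
    | add x y hx hy =>
      simp only [map_add, hx, hy]
      abel
    | tmul x y => simp [coder_ι_mul_ι_mul, TensorProduct.add_tmul]
  apply tensor_hom_ext₂
  · simp [coder_one, comul_one]
  · intro w
    have h := comul_ι_mul w 1
    rw [mul_one, comul_one] at h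
    simp [coder_ι, coder_one, h]
  · intro a b x h
    simp only [LinearMap.comp_apply, LinearMap.add_apply] at h ⊢
    rw [coder_ι_mul_ι_mul, map_add, comul_ι_mul, comul_ι_mul _ (coder 𝒲 d _), h,
      comul_ι_mul a, map_add (TensorProduct.map (tensorParity 𝒲) (coder 𝒲 d)), hP,
      comul_ι_mul b]
    simp only [map_add, hD, TensorProduct.map_tmul, LinearMap.rTensor_tmul, coder_one, coder_ι,
      LinearMap.mul_apply', mul_one, TensorProduct.zero_tmul, zero_add,
      coder_ι_mul_ι_mul, tensorParity_one, TensorProduct.tmul_add, LinearMap.id_apply]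
    abel

theorem algebraMapInv_coder (d : W →ₗ[ℂ] W →ₗ[ℂ] W) (x : TensorAlgebra ℂ W) :
    algebraMapInv (coder 𝒲 d x) = 0 := by
  have h : algebraMapInv.toLinearMap ∘ₗ coder 𝒲 d = 0 := by
    apply tensor_hom_ext₂
    · simp [coder_one]
    · simp [coder_ι]
    · intro a b x _
      simp [coder_ι_mul_ι_mul]
  exact LinearMap.congr_fun h x

theorem ιInv_coder_ι_mul_ι_mul_ι_mul (d : W →ₗ[ℂ] W →ₗ[ℂ] W) (a b c : W)
    (x : TensorAlgebra ℂ W) :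
    ιInv (coder 𝒲 d (ι ℂ a * (ι ℂ b * (ι ℂ c * x)))) = 0 := by
  rw [coder_ι_mul_ι_mul, map_add, ιInv_ι_mul, ιInv_ι_mul, algebraMapInv_coder]
  simp

theorem coder_quadratic (d : W →ₗ[ℂ] W →ₗ[ℂ] W) (n : ℕ) (hn : n ≠ 2)
    (x : TensorAlgebra ℂ W) (hx : x ∈ LinearMap.range (ι ℂ (M := W)) ^ n) :
    ιInv (coder 𝒲 d x) = 0 := by
  have step : ∀ (N P : Submodule ℂ (TensorAlgebra ℂ W)),
      (∀ w, ∀ y ∈ N, ι ℂ w * y ∈ P) → LinearMap.range (ι ℂ (M := W)) * N ≤ P := by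
    intro N P h
    rw [Submodule.mul_le]
    rintro _ ⟨w, rfl⟩ y hy
    exact h w y hy
  match n, hn with
  | 0, _ =>
    rw [pow_zero, Submodule.mem_one] at hx
    obtain ⟨r, rfl⟩ := hx
    simp [Algebra.algebraMap_eq_smul_one, coder_one]
  | 1, _ =>
    rw [pow_one] at hx
    obtain ⟨w, rfl⟩ := hx
    simp [coder_ι]
  | n + 3, _ =>
    -- Membership in `K₁` or `K₂` means landing in `K` after one or two further letters are put in
    -- front. Three leading letters suffice: contracting one pair leaves at least two letters, and
    -- such a word has no component in `W`.
    let K : Submodule ℂ (TensorAlgebra ℂ W) := LinearMap.ker (ιInv ∘ₗ coder 𝒲 d)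
    let K₁ : Submodule ℂ (TensorAlgebra ℂ W) :=
      ⨅ a : W, K.comap (LinearMap.mul ℂ (TensorAlgebra ℂ W) (ι ℂ a))
    let K₂ : Submodule ℂ (TensorAlgebra ℂ W) :=
      ⨅ a : W, K₁.comap (LinearMap.mul ℂ (TensorAlgebra ℂ W) (ι ℂ a))
    have h : LinearMap.range (ι ℂ (M := W)) ^ (n + 3) ≤ K := by
      rw [pow_succ', pow_succ', pow_succ']
      refine step _ _ fun a y hy => ?_
      have h₁ : LinearMap.range (ι ℂ (M := W)) * (LinearMap.range (ι ℂ (M := W)) *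
          LinearMap.range (ι ℂ (M := W)) ^ n) ≤ K₁ := by
        refine step _ _ fun b y hy => ?_
        have h₂ : LinearMap.range (ι ℂ (M := W)) * LinearMap.range (ι ℂ (M := W)) ^ n ≤ K₂ := by
          refine step _ _ fun c y _ => ?_
          simp [K₂, K₁, K, ιInv_coder_ι_mul_ι_mul_ι_mul]
        have := h₂ hy
        simp only [K₂, Submodule.mem_iInf] at this
        exact this b
      have := h₁ hy
      simp only [K₁, Submodule.mem_iInf] at this
      exact this a
    exact h hx

theorem coder_ι_mul_ι_mul_ι (d : W →ₗ[ℂ] W →ₗ[ℂ] W) (a b c : W) :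
    coder 𝒲 d (ι ℂ a * (ι ℂ b * ι ℂ c)) =
      ι ℂ (d a b) * ι ℂ c + ι ℂ (parityOp 𝒲 a) * ι ℂ (d b c) := by
  rw [coder_ι_mul_ι_mul, coder_ι_mul_ι]

/-- In D², contractions of disjoint pairs cancel because d is odd, and overlapping contractions sum
to the stated identity inside a longer word. A three-letter word recovers the identity itself. -/
theorem coder_comp_coder_eq_zero_iff {d : W →ₗ[ℂ] W →ₗ[ℂ] W} (hd : IsOddBilin 𝒲 d) :
    coder 𝒲 d ∘ₗ coder 𝒲 d = 0 ↔
      ∀ a b c, d (d a b) c + d (parityOp 𝒲 a) (d b c) = 0 := by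
  constructor
  · intro h a b c
    have := LinearMap.congr_fun h (ι ℂ a * (ι ℂ b * ι ℂ c))
    rw [LinearMap.comp_apply, coder_ι_mul_ι_mul_ι, map_add, coder_ι_mul_ι, coder_ι_mul_ι,
      ← map_add] at this
    simpa using congrArg ιInv this
  · intro h
    have h₂ : ∀ a b : W, coder 𝒲 d (coder 𝒲 d (ι ℂ a * ι ℂ b)) = 0 := by
      intro a b
      rw [coder_ι_mul_ι, coder_ι]
    -- The claim is carried with zero, one and two letters in front of x, so that it is known for b
    -- c x when a is prepended.
    have key : ∀ x, ((coder 𝒲 d (coder 𝒲 d x) = 0) ∧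
        (∀ b, coder 𝒲 d (coder 𝒲 d (ι ℂ b * x)) = 0)) ∧
        ∀ a b, coder 𝒲 d (coder 𝒲 d (ι ℂ a * (ι ℂ b * x))) = 0 := by
      intro x
      induction x using tensor_induction with
      | one => simp [coder_one, coder_ι, h₂]
      | smul c x hx => exact ⟨⟨by simp [hx.1.1], by simp [hx.1.2]⟩, by simp [hx.2]⟩
      | add x y hx hy =>
        exact ⟨⟨by simp [hx.1.1, hy.1.1], by simp [mul_add, hx.1.2, hy.1.2]⟩,
          by simp [mul_add, hx.2, hy.2]⟩
      | ι_mul c x hx =>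
        refine ⟨⟨hx.1.2 c, fun b => hx.2 b c⟩, fun a b => ?_⟩
        have hbc := hx.2 b c
        rw [coder_ι_mul_ι_mul, map_add] at hbc
        have habc := congrArg (fun z => ι ℂ z * x) (h a b c)
        simp only [map_add, add_mul, map_zero, zero_mul] at habc
        calc coder 𝒲 d (coder 𝒲 d (ι ℂ a * (ι ℂ b * (ι ℂ c * x))))
            = coder 𝒲 d (ι ℂ (d a b) * (ι ℂ c * x)) +
                (coder 𝒲 d (ι ℂ (parityOp 𝒲 a) * (ι ℂ (d b c) * x)) +
                  coder 𝒲 d (ι ℂ (parityOp 𝒲 a) *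
                    (ι ℂ (parityOp 𝒲 b) * coder 𝒲 d (ι ℂ c * x)))) := by
              rw [coder_ι_mul_ι_mul 𝒲 d a, coder_ι_mul_ι_mul 𝒲 d b, mul_add, map_add, map_add]
          _ = (ι ℂ (d (d a b) c) * x + ι ℂ (d (parityOp 𝒲 a) (d b c)) * x) +
                ι ℂ a * (coder 𝒲 d (ι ℂ (d b c) * x) +
                  coder 𝒲 d (ι ℂ (parityOp 𝒲 b) * coder 𝒲 d (ι ℂ c * x))) := by
              rw [coder_ι_mul_ι_mul, coder_ι_mul_ι_mul, coder_ι_mul_ι_mul, hd a b,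
                parityOp_parityOp, map_neg, neg_mul, mul_add]
              abel
          _ = 0 := by rw [habc, hbc, mul_zero, add_zero]
    exact LinearMap.ext fun x => (key x).1.1

theorem algebraMapInv_tensorParity (x : TensorAlgebra ℂ W) :
    algebraMapInv (tensorParity 𝒲 x) = algebraMapInv x := by
  have h : algebraMapInv.toLinearMap ∘ₗ tensorParity 𝒲 =
      (algebraMapInv (R := ℂ) (M := W)).toLinearMap := by
    apply tensor_hom_ext <;> simp
  exact LinearMap.congr_fun h x

theorem ιInv_tensorParity (x : TensorAlgebra ℂ W) :
    ιInv (tensorParity 𝒲 x) = parityOp 𝒲 (ιInv x) := by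
  have h : ιInv ∘ₗ tensorParity 𝒲 = parityOp 𝒲 ∘ₗ (ιInv (R := ℂ) (M := W)) := by
    apply tensor_hom_ext <;> simp [algebraMapInv_tensorParity]
  exact LinearMap.congr_fun h x

/-- The map `x ⊗ y ↦ ε(x) g(y)`, where `ε` is the counit of `T(W)`. -/
noncomputable def counitLeft {M : Type*} [AddCommGroup M] [Module ℂ M]
    (g : TensorAlgebra ℂ W →ₗ[ℂ] M) : TensorAlgebra ℂ W ⊗[ℂ] TensorAlgebra ℂ W →ₗ[ℂ] M :=
  TensorProduct.lift ((LinearMap.lsmul ℂ M).compl₁₂ algebraMapInv.toLinearMap g)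

/-- The map `x ⊗ y ↦ ε(y) g(x)`, where `ε` is the counit of `T(W)`. -/
noncomputable def counitRight {M : Type*} [AddCommGroup M] [Module ℂ M]
    (g : TensorAlgebra ℂ W →ₗ[ℂ] M) : TensorAlgebra ℂ W ⊗[ℂ] TensorAlgebra ℂ W →ₗ[ℂ] M :=
  TensorProduct.lift ((LinearMap.lsmul ℂ M).flip.compl₁₂ g algebraMapInv.toLinearMap)

/-- The map `x ⊗ y ↦ k(x₁) g(y)`, where `x₁` is the component of `x` in `W`. -/
noncomputable def letterLeft (k : W →ₗ[ℂ] W)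
    (g : TensorAlgebra ℂ W →ₗ[ℂ] TensorAlgebra ℂ W) :
    TensorAlgebra ℂ W ⊗[ℂ] TensorAlgebra ℂ W →ₗ[ℂ] TensorAlgebra ℂ W :=
  TensorProduct.lift ((LinearMap.mul ℂ (TensorAlgebra ℂ W)).compl₁₂ (ι ℂ ∘ₗ k ∘ₗ ιInv) g)

theorem counitLeft_comul {M : Type*} [AddCommGroup M] [Module ℂ M]
    (g : TensorAlgebra ℂ W →ₗ[ℂ] M) (x : TensorAlgebra ℂ W) :
    counitLeft g (comul W x) = g x := by
  have hw : ∀ (w : W) (t : TensorAlgebra ℂ W ⊗[ℂ] TensorAlgebra ℂ W),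
      counitLeft g (LinearMap.rTensor _ (LinearMap.mul ℂ (TensorAlgebra ℂ W) (ι ℂ w)) t) = 0 := by
    intro w t
    induction t with
    | zero => simp
    | add x y hx hy => simp only [map_add, hx, hy, add_zero]
    | tmul x y => simp [counitLeft]
  have h : counitLeft g ∘ₗ comul W = g := by
    apply tensor_hom_ext
    · simp [comul_one, counitLeft]
    · intro w x _
      rw [LinearMap.comp_apply, comul_ι_mul, map_add, hw]
      simp [counitLeft]
  exact LinearMap.congr_fun h x

theorem counitRight_comul {M : Type*} [AddCommGroup M] [Module ℂ M]
    (g : TensorAlgebra ℂ W →ₗ[ℂ] M) (x : TensorAlgebra ℂ W) :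
    counitRight g (comul W x) = g x := by
  have hw : ∀ (g : TensorAlgebra ℂ W →ₗ[ℂ] M) (w : W)
      (t : TensorAlgebra ℂ W ⊗[ℂ] TensorAlgebra ℂ W),
      counitRight g (LinearMap.rTensor _ (LinearMap.mul ℂ (TensorAlgebra ℂ W) (ι ℂ w)) t) =
        counitRight (g ∘ₗ LinearMap.mul ℂ (TensorAlgebra ℂ W) (ι ℂ w)) t := by
    intro g w t
    induction t with
    | zero => simp
    | add x y hx hy => simp only [map_add, hx, hy]
    | tmul x y => simp [counitRight]
  induction x using tensor_induction generalizing g with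
  | one => simp [comul_one, counitRight]
  | smul c x hx => simp [hx]
  | add x y hx hy => simp [hx, hy]
  | ι_mul w x hx =>
    rw [comul_ι_mul, map_add, hw, hx]
    simp [counitRight]

theorem letterLeft_comul_ι_mul (k : W →ₗ[ℂ] W)
    (g : TensorAlgebra ℂ W →ₗ[ℂ] TensorAlgebra ℂ W) (w : W) (x : TensorAlgebra ℂ W) :
    letterLeft k g (comul W (ι ℂ w * x)) = ι ℂ (k w) * g x := by
  have hw : ∀ t : TensorAlgebra ℂ W ⊗[ℂ] TensorAlgebra ℂ W,
      letterLeft k g (LinearMap.rTensor _ (LinearMap.mul ℂ (TensorAlgebra ℂ W) (ι ℂ w)) t) =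
        ι ℂ (k w) * counitLeft g t := by
    intro t
    induction t with
    | zero => simp
    | add x y hx hy => simp only [map_add, hx, hy, mul_add]
    | tmul x y => simp [letterLeft, counitLeft]
  rw [comul_ι_mul, map_add, hw, counitLeft_comul]
  simp [letterLeft]

/-- A coderivation with respect to the parity operator is determined by its component in `W`. -/
theorem coderivation_eq_zero {E : TensorAlgebra ℂ W →ₗ[ℂ] TensorAlgebra ℂ W}
    (hE : comul W ∘ₗ E =
      (TensorProduct.map E LinearMap.id + TensorProduct.map (tensorParity 𝒲) E) ∘ₗ comul W)
    (h : ∀ x, ιInv (E x) = 0) : E = 0 := by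
  have hE' : ∀ x, comul W (E x) = TensorProduct.map E LinearMap.id (comul W x) +
      TensorProduct.map (tensorParity 𝒲) E (comul W x) := fun x => LinearMap.congr_fun hE x
  -- Applying the counit to both tensor factors of the coderivation rule gives ε(Ex) = ε(Ex) +
  -- ε(Ex), with ε here the counit.
  have counit : ∀ x, algebraMapInv (E x) = 0 := by
    intro x
    have h₁ : counitLeft algebraMapInv.toLinearMap ∘ₗ TensorProduct.map E LinearMap.id =
        counitRight ((algebraMapInv (R := ℂ) (M := W)).toLinearMap ∘ₗ E) := by
      ext x y
      simp [counitLeft, counitRight, mul_comm]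
    have h₂ : counitLeft algebraMapInv.toLinearMap ∘ₗ TensorProduct.map (tensorParity 𝒲) E =
        counitLeft ((algebraMapInv (R := ℂ) (M := W)).toLinearMap ∘ₗ E) := by
      ext x y
      simp [counitLeft, algebraMapInv_tensorParity]
    have h₃ := counitLeft_comul (algebraMapInv (R := ℂ) (M := W)).toLinearMap (E x)
    have h₄ := LinearMap.congr_fun h₁ (comul W x)
    have h₅ := LinearMap.congr_fun h₂ (comul W x)
    rw [LinearMap.comp_apply, counitRight_comul] at h₄
    rw [LinearMap.comp_apply, counitLeft_comul] at h₅
    rw [hE', map_add, h₄, h₅] at h₃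
    simpa using h₃
  have proj : ∀ x, letterLeft LinearMap.id LinearMap.id (comul W x) +
      algebraMap ℂ _ (algebraMapInv x) = x := by
    intro x
    have h₁ : letterLeft LinearMap.id LinearMap.id ∘ₗ comul W +
        Algebra.linearMap ℂ _ ∘ₗ algebraMapInv.toLinearMap =
        (LinearMap.id : TensorAlgebra ℂ W →ₗ[ℂ] _) := by
      apply tensor_hom_ext
      · simp [comul_one, letterLeft]
      · intro w x _
        simp [letterLeft_comul_ι_mul]
    exact LinearMap.congr_fun h₁ x
  -- Since Ex has no scalar part, it is recovered by multiplying the first letter onto the rest in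
  -- Δ(Ex). The summand E ⊗ 1 drops out because E has no component in `W`. What remains says that
  -- E(wx) = ±wE(x), so E vanishes by induction.
  have split : ∀ x, E x = letterLeft (parityOp 𝒲) E (comul W x) := by
    intro x
    have h₁ : letterLeft LinearMap.id LinearMap.id ∘ₗ TensorProduct.map E LinearMap.id = 0 := by
      ext x y
      simp [letterLeft, h]
    have h₂ : letterLeft LinearMap.id LinearMap.id ∘ₗ TensorProduct.map (tensorParity 𝒲) E =
        letterLeft (parityOp 𝒲) E := by
      ext x y
      simp [letterLeft, ιInv_tensorParity]
    have h₃ := proj (E x)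
    have h₄ := LinearMap.congr_fun h₁ (comul W x)
    have h₅ := LinearMap.congr_fun h₂ (comul W x)
    rw [LinearMap.comp_apply, LinearMap.zero_apply] at h₄
    rw [LinearMap.comp_apply] at h₅
    rw [counit, map_zero, add_zero, hE', map_add, h₄, h₅, zero_add] at h₃
    exact h₃.symm
  apply tensor_hom_ext
  · rw [split, comul_one]
    simp [letterLeft]
  · intro w x hx
    rw [split, letterLeft_comul_ι_mul, hx]
    simp

/-- Take d to be the component of D from two-letter words to `W`. Then D and the extension of d have
equal components in every tensor degree, and their difference is a coderivation with zero component
in `W`. -/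
theorem IsQuadCodiff.exists_eq_coder {D : TensorAlgebra ℂ W →ₗ[ℂ] TensorAlgebra ℂ W}
    (hD : IsQuadCodiff 𝒲 D) : ∃ d, IsOddBilin 𝒲 d ∧ D = coder 𝒲 d := by
  let d : W →ₗ[ℂ] W →ₗ[ℂ] W :=
    ((LinearMap.mul ℂ (TensorAlgebra ℂ W)).compl₁₂ (ι ℂ) (ι ℂ)).compr₂ (ιInv ∘ₗ D)
  have hd : ∀ a b, d a b = ιInv (D (ι ℂ a * ι ℂ b)) := fun a b => rfl
  refine ⟨d, fun a b => ?_, sub_eq_zero.1 (coderivation_eq_zero 𝒲 ?_ ?_)⟩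
  · have h := LinearMap.congr_fun hD.odd (ι ℂ a * ι ℂ b)
    simp only [LinearMap.comp_apply, LinearMap.neg_apply, tensorParity_ι_mul,
      tensorParity_ι] at h
    rw [hd, hd, h, map_neg, neg_neg, ιInv_tensorParity]
  · rw [LinearMap.comp_sub, hD.coderivation, coder_coderivation, ← LinearMap.sub_comp]
    congr 1
    ext x y
    simp only [TensorProduct.AlgebraTensorModule.curry_apply, TensorProduct.curry_apply,
      LinearMap.coe_restrictScalars, LinearMap.sub_apply, LinearMap.add_apply,
      TensorProduct.map_tmul, TensorProduct.sub_tmul, TensorProduct.tmul_sub]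
    abel
  · intro x
    induction x using DirectSum.Decomposition.inductionOn
      (fun n : ℕ => LinearMap.range (ι ℂ (M := W)) ^ n) with
    | zero => simp
    | add x y hx hy => rw [map_add, map_add, hx, hy, add_zero]
    | @homogeneous n x =>
      obtain ⟨x, hx⟩ := x
      by_cases hn : n = 2
      · subst hn
        change ιInv ((D - coder 𝒲 d) x) = 0
        rw [pow_two] at hx
        induction hx using Submodule.mul_induction_on' with
        | mem_mul_mem u hu v hv =>
          obtain ⟨a, rfl⟩ := hu
          obtain ⟨b, rfl⟩ := hv
          simp [coder_ι_mul_ι, hd]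
        | add u _ v _ hu hv => rw [map_add, map_add, hu, hv, add_zero]
      · simp [hD.quadratic n hn x hx, coder_quadratic 𝒲 d n hn x hx]

theorem isQuadCodiff_coder_iff {d : W →ₗ[ℂ] W →ₗ[ℂ] W} (hd : IsOddBilin 𝒲 d) :
    IsQuadCodiff 𝒲 (coder 𝒲 d) ↔
      ∀ a b c, d (d a b) c + d (parityOp 𝒲 a) (d b c) = 0 :=
  ⟨fun h => (coder_comp_coder_eq_zero_iff 𝒲 hd).1 h.sq_zero, fun h =>
    ⟨coder_odd 𝒲 hd, coder_coderivation 𝒲 d, coder_quadratic 𝒲 d,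
      (coder_comp_coder_eq_zero_iff 𝒲 hd).2 h⟩⟩

theorem tensorMap_comp_coder_iff {g : W →ₗ[ℂ] W}
    (hg : ∀ w, g (parityOp 𝒲 w) = parityOp 𝒲 (g w)) (d d' : W →ₗ[ℂ] W →ₗ[ℂ] W) :
    tensorMap g ∘ₗ coder 𝒲 d = coder 𝒲 d' ∘ₗ tensorMap g ↔
      ∀ a b, g (d a b) = d' (g a) (g b) := by
  constructor
  · intro h a b
    have := LinearMap.congr_fun h (ι ℂ a * ι ℂ b)
    simp only [LinearMap.comp_apply, coder_ι_mul_ι, tensorMap_mul, tensorMap_ι] at this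
    simpa using congrArg ιInv this
  · intro h
    apply tensor_hom_ext₂
    · simp [coder_one]
    · simp [coder_ι]
    · intro a b x hx
      simp only [LinearMap.comp_apply, tensorMap_mul, tensorMap_ι] at hx ⊢
      simp [coder_ι_mul_ι_mul, hx, h, hg]

end Coder

/-! ### Algebra structures correspond to codifferentials. -/

section Correspondence

variable {A : Type*} [AddCommGroup A] [Module ℂ A]
  (𝒜 : ZMod 2 → Submodule ℂ A) [DirectSum.Decomposition 𝒜]

theorem isGradedAssoc_iff (m : A →ₗ[ℂ] A →ₗ[ℂ] A) :
    IsGradedAssoc 𝒜 m ↔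
      IsOddBilin (parityRev 𝒜) m ∧ ∀ a b c : A, m (m a b) c = m a (m b c) :=
  ⟨fun h => ⟨(graded_iff 𝒜 m).1 h.graded, h.assoc⟩,
    fun h => ⟨(graded_iff 𝒜 m).2 h.1, h.2⟩⟩

theorem isQuadCodiff_codiffOfAlg_iff {m : A →ₗ[ℂ] A →ₗ[ℂ] A}
    (hm : IsOddBilin (parityRev 𝒜) m) :
    IsQuadCodiff (parityRev 𝒜) (codiffOfAlg 𝒜 m) ↔ IsGradedAssoc 𝒜 m := by
  rw [codiffOfAlg, isQuadCodiff_coder_iff _ (hm.shift 𝒜), isGradedAssoc_iff, and_iff_right hm]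
  -- Oddness gives εm(εa,b) = -m(a,εb). The sign turns the sum into an associator with middle
  -- argument εb, and b ↦ εb is a bijection.
  have key : ∀ a b c, shift 𝒜 m (shift 𝒜 m a b) c +
      shift 𝒜 m (parityOp (parityRev 𝒜) a) (shift 𝒜 m b c) =
      m a (m (parityOp (parityRev 𝒜) b) c) - m (m a (parityOp (parityRev 𝒜) b)) c := by
    intro a b c
    simp only [shift_apply, parityOp_parityOp, hm _ b, map_neg, LinearMap.neg_apply]
    abel
  simp only [key, sub_eq_zero]
  refine ⟨fun h a b c => ?_, fun h a b c => (h a _ c).symm⟩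
  simpa using (h a (parityOp (parityRev 𝒜) b) c).symm

theorem codiffOfAlg_bijOn :
    Set.BijOn (codiffOfAlg 𝒜) {m | IsGradedAssoc 𝒜 m}
      {D | IsQuadCodiff (parityRev 𝒜) D} := by
  refine ⟨fun m hm => ?_, fun m _ m' _ h => ?_, fun D hD => ?_⟩
  · exact (isQuadCodiff_codiffOfAlg_iff 𝒜 ((isGradedAssoc_iff 𝒜 m).1 hm).1).2 hm
  · rw [← shift_shift 𝒜 m, coder_injective _ h, shift_shift]
  · obtain ⟨d, hd, rfl⟩ := hD.exists_eq_coder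
    have h : codiffOfAlg 𝒜 (shift 𝒜 d) = coder (parityRev 𝒜) d := by
      rw [codiffOfAlg, shift_shift]
    refine ⟨shift 𝒜 d, ?_, h⟩
    rw [Set.mem_ofPred_eq, ← h, isQuadCodiff_codiffOfAlg_iff 𝒜 (hd.shift 𝒜)] at hD
    exact hD

theorem algIso_iff_codiffEquiv (m m' : A →ₗ[ℂ] A →ₗ[ℂ] A) :
    AlgIso 𝒜 m m' ↔
      CodiffEquiv (parityRev 𝒜) (codiffOfAlg 𝒜 m) (codiffOfAlg 𝒜 m') := by
  refine exists_congr fun g => ?_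
  have hrev : (∀ i : ZMod 2, ∀ a ∈ 𝒜 i, g a ∈ 𝒜 i) ↔
      ∀ i : ZMod 2, ∀ a ∈ parityRev 𝒜 i, g a ∈ parityRev 𝒜 i :=
    ⟨fun h i => h (i + 1), fun h i => by simpa [parityRev] using h (i - 1)⟩
  rw [hrev]
  refine and_congr_right fun hg => ?_
  have hg' := (preserves_grading_iff (parityRev 𝒜) g.toLinearMap).1 hg
  rw [codiffOfAlg, codiffOfAlg, tensorMap_comp_coder_iff _ hg']
  simp only [LinearEquiv.coe_coe] at hg'
  simp only [shift_apply, LinearEquiv.coe_coe, ← hg']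
  -- Both sides now carry ε on the first argument only, and ε is an involution.
  refine ⟨fun h a b => h _ b, fun h a b => ?_⟩
  simpa using h (parityOp (parityRev 𝒜) a) b

end Correspondence

/-! ### Integer structure constants of the 28 tables. -/

section Constants

/-- The structure constants of the bilinear map `(v i, v j) ↦ v k`. -/
def elemConst (i j k : Fin 3) : Fin 3 → Fin 3 → Fin 3 → ℤ :=
  fun p q r => if p = i ∧ q = j ∧ r = k then 1 else 0

/-- The structure constants of the bilinear maps `dTable`. -/
def dConst : Fin 28 → (Fin 3 → Fin 3 → Fin 3 → ℤ) :=
  let ψ : Fin 3 → Fin 3 → Fin 3 → (Fin 3 → Fin 3 → Fin 3 → ℤ) :=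
    fun i j k => elemConst (i - 1) (j - 1) (k - 1)
  ![ψ 1 3 1 - ψ 3 1 1 + ψ 1 1 3 + ψ 2 2 2 - ψ 3 3 3,
    ψ 1 3 1 - ψ 3 1 1 + ψ 1 1 3 - ψ 3 3 3,
    ψ 2 2 2 + ψ 3 3 3 - ψ 1 2 1,
    ψ 2 2 2 + ψ 3 3 3 + ψ 2 1 1,
    ψ 2 2 2 + ψ 3 3 3 + ψ 2 1 1 - ψ 1 3 1,
    ψ 2 2 2 + ψ 3 3 3 + ψ 2 1 1 - ψ 1 2 1,
    ψ 2 2 2 + ψ 3 3 3,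
    ψ 3 3 3 + ψ 1 1 2 + ψ 3 1 1 - ψ 1 3 1 + ψ 3 2 2 + ψ 2 3 2,
    ψ 3 3 3 + ψ 1 1 2,
    ψ 3 3 3 - ψ 1 3 1 + ψ 2 3 2,
    ψ 3 3 3 + ψ 3 1 1 + ψ 3 2 2,
    ψ 3 3 3 + ψ 3 1 1 + ψ 2 3 2,
    ψ 3 3 3 - ψ 1 3 1 + ψ 3 2 2,
    ψ 3 3 3 + ψ 3 1 1 - ψ 1 3 1 + ψ 2 3 2,
    ψ 3 3 3 + ψ 3 1 1 - ψ 1 3 1 + ψ 3 2 2,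
    ψ 3 3 3 + ψ 2 3 2,
    ψ 3 3 3 + ψ 3 2 2,
    ψ 3 3 3 - ψ 1 3 1 + ψ 2 3 2 + ψ 3 2 2,
    ψ 3 3 3 + ψ 3 1 1 + ψ 2 3 2 + ψ 3 2 2,
    ψ 3 3 3 + ψ 2 3 2 + ψ 3 2 2,
    ψ 3 3 3 - ψ 1 3 1,
    ψ 3 3 3 + ψ 3 1 1,
    ψ 3 3 3 - ψ 1 3 1 + ψ 3 1 1,
    ψ 3 3 3 - ψ 1 3 1 + ψ 3 1 1 + ψ 2 3 2 + ψ 3 2 2,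
    ψ 3 3 3,
    ψ 1 1 2 + ψ 3 3 2,
    ψ 1 1 2,
    ψ 3 3 2]

/-- The parity signs of the basis vectors `v 0` (even), `v 1` and `v 2` (odd). -/
def basisSign : Fin 3 → ℤ := ![1, -1, -1]

/-- The structure constants of the algebras that correspond to `dTable`. -/
def algConst (n : Fin 28) (i j k : Fin 3) : ℤ := basisSign i * dConst n i j k

/-- `m` has the structure constants `c` in the basis `v`. -/
def HasConstants {A : Type*} [AddCommGroup A] [Module ℂ A] (v : Module.Basis (Fin 3) ℂ A)
    (m : A →ₗ[ℂ] A →ₗ[ℂ] A) (c : Fin 3 → Fin 3 → Fin 3 → ℤ) : Prop :=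
  ∀ i j, m (v i) (v j) = ∑ k, (c i j k : ℂ) • v k

variable {A : Type*} [AddCommGroup A] [Module ℂ A]

theorem hasConstants_elem (v : Module.Basis (Fin 3) ℂ A) (i j k : Fin 3) :
    HasConstants v (elem v i j k) (elemConst i j k) := by
  intro p q
  by_cases h : p = i ∧ q = j <;> simp [elem_basis, elemConst, ← and_assoc, h]

theorem HasConstants.add {v : Module.Basis (Fin 3) ℂ A} {m m' : A →ₗ[ℂ] A →ₗ[ℂ] A}
    {c c' : Fin 3 → Fin 3 → Fin 3 → ℤ} (h : HasConstants v m c) (h' : HasConstants v m' c') :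
    HasConstants v (m + m') (c + c') := by
  intro i j
  simp [h i j, h' i j, add_smul, Finset.sum_add_distrib]

theorem HasConstants.sub {v : Module.Basis (Fin 3) ℂ A} {m m' : A →ₗ[ℂ] A →ₗ[ℂ] A}
    {c c' : Fin 3 → Fin 3 → Fin 3 → ℤ} (h : HasConstants v m c) (h' : HasConstants v m' c') :
    HasConstants v (m - m') (c - c') := by
  intro i j
  simp [h i j, h' i j, sub_smul, Finset.sum_sub_distrib]

/-- `dTable` and `dConst` are the same expressions in elementary maps, so the proof follows their
sums and differences. -/
theorem hasConstants_dTable (v : Module.Basis (Fin 3) ℂ A) (n : Fin 28) :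
    HasConstants v (dTable v n) (dConst n) := by
  fin_cases n <;>
  repeat' first
    | exact hasConstants_elem v _ _ _
    | apply HasConstants.add
    | apply HasConstants.sub

end Constants

/-! ### Transfer from structure constants to algebras. -/

section Adapted

variable {A : Type*} [AddCommGroup A] [Module ℂ A]
  {𝒜 : ZMod 2 → Submodule ℂ A} [DirectSum.Decomposition 𝒜]
  {v : Module.Basis (Fin 3) ℂ A}

theorem IsAdapted.parityOp_apply (hv : IsAdapted (parityRev 𝒜) v) (i : Fin 3) :
    parityOp (parityRev 𝒜) (v i) = (basisSign i : ℂ) • v i := by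
  fin_cases i
  · simpa [basisSign] using parityOp_even _ hv.1
  · simpa [basisSign] using parityOp_odd _ hv.2.1
  · simpa [basisSign] using parityOp_odd _ hv.2.2

theorem IsAdapted.hasConstants_shift (hv : IsAdapted (parityRev 𝒜) v) (n : Fin 28) :
    HasConstants v (shift 𝒜 (dTable v n)) (algConst n) := by
  intro i j
  simp [hv.parityOp_apply, hasConstants_dTable v n i j, algConst, Finset.smul_sum, smul_smul]

theorem HasConstants.isOddBilin (hv : IsAdapted (parityRev 𝒜) v) {m : A →ₗ[ℂ] A →ₗ[ℂ] A}
    {c : Fin 3 → Fin 3 → Fin 3 → ℤ} (h : HasConstants v m c)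
    (hc : ∀ i j k, c i j k * basisSign k = -(basisSign j * (basisSign i * c i j k))) :
    IsOddBilin (parityRev 𝒜) m := by
  have key : m.compr₂ (parityOp (parityRev 𝒜)) =
      -m.compl₁₂ (parityOp (parityRev 𝒜)) (parityOp (parityRev 𝒜)) := by
    refine v.ext fun i => v.ext fun j => ?_
    simp only [LinearMap.compr₂_apply, LinearMap.neg_apply, LinearMap.compl₁₂_apply,
      hv.parityOp_apply, map_smul, LinearMap.smul_apply, h i j, map_sum, Finset.smul_sum,
      smul_smul, ← Finset.sum_neg_distrib, ← neg_smul]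
    refine Finset.sum_congr rfl fun k _ => ?_
    congr 1
    exact_mod_cast (hc i j k)
  exact fun a b => LinearMap.congr_fun₂ key a b

theorem HasConstants.assoc {m : A →ₗ[ℂ] A →ₗ[ℂ] A}
    {c : Fin 3 → Fin 3 → Fin 3 → ℤ} (h : HasConstants v m c)
    (hc : ∀ i j k l, ∑ p, c i j p * c p k l = ∑ p, c j k p * c i p l) (a b d : A) :
    m (m a b) d = m a (m b d) := by
  have key : m.compr₂ m = (LinearMap.llcomp ℂ A A A ∘ₗ m).compl₂ m := by
    refine v.ext fun i => v.ext fun j => v.ext fun k => ?_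
    have hl : m (m (v i) (v j)) (v k) = ∑ l, ((∑ p, c i j p * c p k l : ℤ) : ℂ) • v l := by
      simp only [h i j, map_sum, map_smul, LinearMap.sum_apply, LinearMap.smul_apply, h _ k,
        Finset.smul_sum, smul_smul]
      rw [Finset.sum_comm]
      simp [Finset.sum_smul]
    have hr : m (v i) (m (v j) (v k)) = ∑ l, ((∑ p, c j k p * c i p l : ℤ) : ℂ) • v l := by
      simp only [h j k, map_sum, map_smul, h i _, Finset.smul_sum, smul_smul]
      rw [Finset.sum_comm]
      simp [Finset.sum_smul]
    change m (m (v i) (v j)) (v k) = m (v i) (m (v j) (v k))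
    rw [hl, hr]
    exact Finset.sum_congr rfl fun l _ => by rw [hc i j k l]
  exact LinearMap.congr_fun (LinearMap.congr_fun₂ key a b) d

/-- On basis vectors, oddness and associativity become identities between integers, which are
checked by evaluation for all tables together. -/
theorem isGradedAssoc_dTable (hv : IsAdapted (parityRev 𝒜) v) (n : Fin 28) :
    IsGradedAssoc 𝒜 (shift 𝒜 (dTable v n)) := by
  have h := hv.hasConstants_shift n
  refine (isGradedAssoc_iff 𝒜 _).2 ⟨h.isOddBilin hv ?_, h.assoc ?_⟩
  · clear h
    revert n
    decide +kernel
  · clear h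
    revert n
    decide +kernel

theorem HasConstants.eq_zero {m : A →ₗ[ℂ] A →ₗ[ℂ] A}
    {c : Fin 3 → Fin 3 → Fin 3 → ℤ} (h : HasConstants v m c) (hm : m = 0) (i j k : Fin 3) :
    c i j k = 0 := by
  have hij := h i j
  rw [hm] at hij
  exact_mod_cast Fintype.linearIndependent_iff.1 v.linearIndependent _ hij.symm k

theorem shift_dTable_ne_zero (hv : IsAdapted (parityRev 𝒜) v) (n : Fin 28) :
    shift 𝒜 (dTable v n) ≠ 0 := by
  intro h
  have h0 := (hv.hasConstants_shift n).eq_zero h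
  clear h
  revert n
  decide +kernel

/-- The linear map that carries one basis to the other intertwines the products, and it is even
because both bases are adapted. -/
theorem HasConstants.algIso {v' : Module.Basis (Fin 3) ℂ A} (hv : IsAdapted (parityRev 𝒜) v)
    (hv' : IsAdapted (parityRev 𝒜) v') {m m' : A →ₗ[ℂ] A →ₗ[ℂ] A}
    {c : Fin 3 → Fin 3 → Fin 3 → ℤ} (h : HasConstants v m c) (h' : HasConstants v' m' c) :
    AlgIso 𝒜 m m' := by
  let g := v.equiv v' (Equiv.refl _)
  have hg : ∀ i, g (v i) = v' i := fun i => by simp [g]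
  have hgε : g.toLinearMap ∘ₗ parityOp (parityRev 𝒜) =
      parityOp (parityRev 𝒜) ∘ₗ g.toLinearMap := by
    refine v.ext fun i => ?_
    simp [hv.parityOp_apply, hv'.parityOp_apply, hg]
  have hgrade := (preserves_grading_iff (parityRev 𝒜) g.toLinearMap).2
    (LinearMap.congr_fun hgε)
  have hmul : m.compr₂ g.toLinearMap = m'.compl₁₂ g.toLinearMap g.toLinearMap := by
    refine v.ext fun i => v.ext fun j => ?_
    simp [h i j, hg, h' i j]
  exact ⟨g, fun i => by simpa [parityRev] using hgrade (i - 1),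
    fun a b => LinearMap.congr_fun₂ hmul a b⟩

end Adapted

/-! ### Invariants that separate the 28 algebras. -/

section Invariants

variable {A : Type*} [AddCommGroup A] [Module ℂ A]
  (𝒜 : ZMod 2 → Submodule ℂ A) [DirectSum.Decomposition 𝒜]

/-- The combination `α tr(L) + β tr(Lε) + γ tr(R) + δ tr(Rε)`, where `L` and `R` are the left and
right multiplications by `a` and `ε` is the parity operator. -/
noncomputable def traceForm (m : A →ₗ[ℂ] A →ₗ[ℂ] A) (α β γ δ : ℤ) (a : A) : ℂ :=
  α * LinearMap.trace ℂ A (m a) + β * LinearMap.trace ℂ A (m a ∘ₗ parityOp (parityRev 𝒜)) +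
    (γ * LinearMap.trace ℂ A (m.flip a) +
      δ * LinearMap.trace ℂ A (m.flip a ∘ₗ parityOp (parityRev 𝒜)))

/-- The product vanishes on the elements `a + s εa`. -/
def ProductVanishes (m : A →ₗ[ℂ] A →ₗ[ℂ] A) (s : ℤ) : Prop :=
  ∀ a b, m (a + (s : ℂ) • parityOp (parityRev 𝒜) a) (b + (s : ℂ) • parityOp (parityRev 𝒜) b) = 0

/-- A list of isomorphism invariants of graded algebra structures. -/
def Invariant (m : A →ₗ[ℂ] A →ₗ[ℂ] A) : Fin 10 → Prop :=
  ![ProductVanishes 𝒜 m 1, ProductVanishes 𝒜 m (-1),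
    ∀ a, traceForm 𝒜 m 1 1 0 0 a = 0,
    ∀ a, traceForm 𝒜 m 0 0 1 1 a = 0,
    ∀ a, traceForm 𝒜 m 1 1 (-1) (-1) a = 0,
    ∀ a, traceForm 𝒜 m 0 1 0 0 a = 0,
    ∀ a, traceForm 𝒜 m 1 (-1) (-2) 2 a = 0,
    ∀ a, traceForm 𝒜 m (-2) 2 1 (-1) a = 0,
    ∀ a b, 2 * traceForm 𝒜 m 1 (-1) 0 0 (m a b) =
      traceForm 𝒜 m 1 (-1) 0 0 a * traceForm 𝒜 m 1 (-1) 0 0 b,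
    ∀ a b, 4 * traceForm 𝒜 m 1 (-1) 0 0 (m a b) =
      traceForm 𝒜 m 1 (-1) 0 0 a * traceForm 𝒜 m 1 (-1) 0 0 b]

/-- The coordinates of `traceForm` in terms of structure constants. -/
def traceFormConst (c : Fin 3 → Fin 3 → Fin 3 → ℤ) (α β γ δ : ℤ) (i : Fin 3) : ℤ :=
  α * ∑ k, c i k k + β * ∑ k, basisSign k * c i k k +
    (γ * ∑ k, c k i k + δ * ∑ k, basisSign k * c k i k)

/-- `Invariant` in terms of structure constants. -/
def invariantConst (c : Fin 3 → Fin 3 → Fin 3 → ℤ) : Fin 10 → Bool :=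
  ![decide (∀ i j k, (1 + 1 * basisSign i) * ((1 + 1 * basisSign j) * c i j k) = 0),
    decide (∀ i j k, (1 + -1 * basisSign i) * ((1 + -1 * basisSign j) * c i j k) = 0),
    decide (∀ i, traceFormConst c 1 1 0 0 i = 0),
    decide (∀ i, traceFormConst c 0 0 1 1 i = 0),
    decide (∀ i, traceFormConst c 1 1 (-1) (-1) i = 0),
    decide (∀ i, traceFormConst c 0 1 0 0 i = 0),
    decide (∀ i, traceFormConst c 1 (-1) (-2) 2 i = 0),
    decide (∀ i, traceFormConst c (-2) 2 1 (-1) i = 0),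
    decide (∀ i j, 2 * ∑ k, c i j k * traceFormConst c 1 (-1) 0 0 k =
      traceFormConst c 1 (-1) 0 0 i * traceFormConst c 1 (-1) 0 0 j),
    decide (∀ i j, 4 * ∑ k, c i j k * traceFormConst c 1 (-1) 0 0 k =
      traceFormConst c 1 (-1) 0 0 i * traceFormConst c 1 (-1) 0 0 j)]

/-- As 1 + ε and 1 - ε are twice the projections onto A₁ and A₀, the first two invariants say A₁A₁ =
0 and A₀A₀ = 0. With L and R the left and right multiplications, the next three say that the trace
on A₁ of L, of R, or of L - R is zero. The sixth is the vanishing of the supertrace of L. The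
seventh and eighth compare traces on A₀: tr L = 2 tr R and tr R = 2 tr L, which detects one-sided
units. The last two ask whether the trace of L on A₀, or half of it, is multiplicative on A. -/
theorem invariantConst_injective :
    Function.Injective fun n => invariantConst (algConst n) := by
  have h : ∀ n n', invariantConst (algConst n) = invariantConst (algConst n') → n = n' := by
    decide +kernel
  exact fun n n' => h n n'

variable {𝒜}

theorem traceForm_add (m : A →ₗ[ℂ] A →ₗ[ℂ] A) (α β γ δ : ℤ) (a b : A) :
    traceForm 𝒜 m α β γ δ (a + b) = traceForm 𝒜 m α β γ δ a + traceForm 𝒜 m α β γ δ b := by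
  simp only [traceForm, map_add, LinearMap.add_comp]
  ring

theorem traceForm_smul (m : A →ₗ[ℂ] A →ₗ[ℂ] A) (α β γ δ : ℤ) (t : ℂ) (a : A) :
    traceForm 𝒜 m α β γ δ (t • a) = t * traceForm 𝒜 m α β γ δ a := by
  simp only [traceForm, map_smul, LinearMap.smul_comp, smul_eq_mul]
  ring

/-- `traceForm` as a linear map. -/
noncomputable def traceFormLin (𝒜 : ZMod 2 → Submodule ℂ A) [DirectSum.Decomposition 𝒜]
    (m : A →ₗ[ℂ] A →ₗ[ℂ] A) (α β γ δ : ℤ) : A →ₗ[ℂ] ℂ where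
  toFun := traceForm 𝒜 m α β γ δ
  map_add' := traceForm_add m α β γ δ
  map_smul' := traceForm_smul m α β γ δ

theorem AlgIso.symm {m m' : A →ₗ[ℂ] A →ₗ[ℂ] A} (h : AlgIso 𝒜 m m') : AlgIso 𝒜 m' m := by
  obtain ⟨g, hg, h⟩ := h
  have hg' := (preserves_grading_iff 𝒜 g.toLinearMap).1 hg
  refine ⟨g.symm, (preserves_grading_iff 𝒜 g.symm.toLinearMap).2 fun w => ?_, fun a b => ?_⟩
  · apply g.injective
    simpa using (hg' (g.symm w)).symm
  · apply g.injective
    simp [h]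

/-- An isomorphism conjugates left and right multiplications into those by the image element and
fixes ε, so the traces agree. One implication is enough because isomorphism is symmetric. -/
theorem AlgIso.invariant_imp {m m' : A →ₗ[ℂ] A →ₗ[ℂ] A} (h : AlgIso 𝒜 m m') (i : Fin 10) :
    Invariant 𝒜 m' i → Invariant 𝒜 m i := by
  obtain ⟨g, hg, h⟩ := h
  have hε := (preserves_grading_iff (parityRev 𝒜) g.toLinearMap).1 fun i => hg (i + 1)
  simp only [LinearEquiv.coe_coe] at hε
  have hprod : ∀ s, ProductVanishes 𝒜 m' s → ProductVanishes 𝒜 m s := by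
    intro s hs a b
    apply g.injective
    simpa [h, hε] using hs (g a) (g b)
  have htr : ∀ α β γ δ a, traceForm 𝒜 m' α β γ δ (g a) = traceForm 𝒜 m α β γ δ a := by
    intro α β γ δ a
    have h₁ : m' (g a) = g.conj (m a) := by
      ext b
      simp [LinearEquiv.conj_apply, h]
    have h₂ : m'.flip (g a) = g.conj (m.flip a) := by
      ext b
      simp [LinearEquiv.conj_apply, h]
    have h₃ : parityOp (parityRev 𝒜) = g.conj (parityOp (parityRev 𝒜)) := by
      ext b
      simp [LinearEquiv.conj_apply, hε]
    rw [traceForm, h₁, h₂, h₃, ← LinearEquiv.conj_comp, ← LinearEquiv.conj_comp]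
    simp only [LinearMap.trace_conj']
    rfl
  have hlin : ∀ α β γ δ, (∀ a, traceForm 𝒜 m' α β γ δ a = 0) →
      ∀ a, traceForm 𝒜 m α β γ δ a = 0 := fun α β γ δ h' a => by rw [← htr, h']
  fin_cases i
  · exact hprod _
  · exact hprod _
  · exact hlin _ _ _ _
  · exact hlin _ _ _ _
  · exact hlin _ _ _ _
  · exact hlin _ _ _ _
  · exact hlin _ _ _ _
  · exact hlin _ _ _ _
  · intro h' a b
    simpa only [← htr, h] using h' (g a) (g b)
  · intro h' a b
    simpa only [← htr, h] using h' (g a) (g b)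

theorem AlgIso.invariant_iff {m m' : A →ₗ[ℂ] A →ₗ[ℂ] A} (h : AlgIso 𝒜 m m') (i : Fin 10) :
    Invariant 𝒜 m i ↔ Invariant 𝒜 m' i :=
  ⟨h.symm.invariant_imp i, h.invariant_imp i⟩

variable {v : Module.Basis (Fin 3) ℂ A} {m : A →ₗ[ℂ] A →ₗ[ℂ] A}
  {c : Fin 3 → Fin 3 → Fin 3 → ℤ}

theorem trace_eq_sum_coord (v : Module.Basis (Fin 3) ℂ A) (f : A →ₗ[ℂ] A) :
    LinearMap.trace ℂ A f = ∑ k, v.repr (f (v k)) k := by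
  simp [LinearMap.trace_eq_matrix_trace ℂ v f, Matrix.trace, LinearMap.toMatrix_apply]

theorem HasConstants.repr_apply (h : HasConstants v m c) (i j k : Fin 3) :
    v.repr (m (v i) (v j)) k = c i j k := by
  simp [h i j, Finsupp.single_apply]

theorem HasConstants.traceForm_basis (hv : IsAdapted (parityRev 𝒜) v) (h : HasConstants v m c)
    (α β γ δ : ℤ) (i : Fin 3) :
    traceForm 𝒜 m α β γ δ (v i) = (traceFormConst c α β γ δ i : ℂ) := by
  simp [traceForm, traceFormConst, trace_eq_sum_coord v, hv.parityOp_apply, h.repr_apply]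

theorem HasConstants.traceForm_eq_zero_iff (hv : IsAdapted (parityRev 𝒜) v)
    (h : HasConstants v m c) (α β γ δ : ℤ) :
    (∀ a, traceForm 𝒜 m α β γ δ a = 0) ↔ ∀ i, traceFormConst c α β γ δ i = 0 := by
  constructor
  · intro h' i
    have := h.traceForm_basis hv α β γ δ i
    rw [h'] at this
    exact_mod_cast this.symm
  · intro h' a
    have h0 : traceFormLin 𝒜 m α β γ δ = 0 := v.ext fun i =>
      (h.traceForm_basis hv α β γ δ i).trans (by simp [h' i])
    exact LinearMap.congr_fun h0 a

theorem HasConstants.productVanishes_iff (hv : IsAdapted (parityRev 𝒜) v)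
    (h : HasConstants v m c) (s : ℤ) :
    ProductVanishes 𝒜 m s ↔
      ∀ i j k, (1 + s * basisSign i) * ((1 + s * basisSign j) * c i j k) = 0 := by
  have hb : ∀ i j, m (v i + (s : ℂ) • parityOp (parityRev 𝒜) (v i))
      (v j + (s : ℂ) • parityOp (parityRev 𝒜) (v j)) =
      ∑ k, (((1 + s * basisSign i) * ((1 + s * basisSign j) * c i j k) : ℤ) : ℂ) • v k := by
    intro i j
    have hs : ∀ i, v i + (s : ℂ) • parityOp (parityRev 𝒜) (v i) =
        ((1 + s * basisSign i : ℤ) : ℂ) • v i := by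
      intro i
      rw [hv.parityOp_apply]
      push_cast
      module
    rw [hs, hs]
    simp only [map_smul, LinearMap.smul_apply, h i j, Finset.smul_sum, smul_smul]
    refine Finset.sum_congr rfl fun k _ => ?_
    push_cast
    congr 1
    ring
  constructor
  · intro h' i j k
    have hij := hb i j
    rw [h'] at hij
    exact_mod_cast Fintype.linearIndependent_iff.1 v.linearIndependent _ hij.symm k
  · intro h' a b
    let p : A →ₗ[ℂ] A := LinearMap.id + (s : ℂ) • parityOp (parityRev 𝒜)
    have h0 : m.compl₁₂ p p = 0 := by
      refine v.ext fun i => v.ext fun j => ?_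
      exact (hb i j).trans (by simp [h' i j])
    exact LinearMap.congr_fun₂ h0 a b

theorem HasConstants.traceForm_mul_iff (hv : IsAdapted (parityRev 𝒜) v)
    (h : HasConstants v m c) (t : ℤ) (α β γ δ : ℤ) :
    (∀ a b, (t : ℂ) * traceForm 𝒜 m α β γ δ (m a b) =
        traceForm 𝒜 m α β γ δ a * traceForm 𝒜 m α β γ δ b) ↔
      ∀ i j, t * ∑ k, c i j k * traceFormConst c α β γ δ k =
        traceFormConst c α β γ δ i * traceFormConst c α β γ δ j := by
  have hb : ∀ i j, traceForm 𝒜 m α β γ δ (m (v i) (v j)) =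
      ((∑ k, c i j k * traceFormConst c α β γ δ k : ℤ) : ℂ) := by
    intro i j
    change traceFormLin 𝒜 m α β γ δ (m (v i) (v j)) = _
    rw [h i j, map_sum]
    push_cast
    refine Finset.sum_congr rfl fun k _ => ?_
    rw [map_smul, ← h.traceForm_basis hv]
    rfl
  constructor
  · intro h' i j
    have hij := h' (v i) (v j)
    rw [hb, h.traceForm_basis hv, h.traceForm_basis hv] at hij
    exact_mod_cast hij
  · intro h' a b
    have h0 : (t : ℂ) • m.compr₂ (traceFormLin 𝒜 m α β γ δ) =
        (LinearMap.mul ℂ ℂ).compl₁₂ (traceFormLin 𝒜 m α β γ δ) (traceFormLin 𝒜 m α β γ δ) := by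
      refine v.ext fun i => v.ext fun j => ?_
      change (t : ℂ) * traceForm 𝒜 m α β γ δ (m (v i) (v j)) =
        traceForm 𝒜 m α β γ δ (v i) * traceForm 𝒜 m α β γ δ (v j)
      rw [hb, h.traceForm_basis hv, h.traceForm_basis hv]
      exact_mod_cast h' i j
    exact LinearMap.congr_fun₂ h0 a b

theorem HasConstants.invariant_iff (hv : IsAdapted (parityRev 𝒜) v)
    (h : HasConstants v m c) (i : Fin 10) : Invariant 𝒜 m i ↔ invariantConst c i = true := by
  fin_cases i
  · exact (h.productVanishes_iff hv 1).trans decide_eq_true_iff.symm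
  · exact (h.productVanishes_iff hv (-1)).trans decide_eq_true_iff.symm
  · exact (h.traceForm_eq_zero_iff hv _ _ _ _).trans decide_eq_true_iff.symm
  · exact (h.traceForm_eq_zero_iff hv _ _ _ _).trans decide_eq_true_iff.symm
  · exact (h.traceForm_eq_zero_iff hv _ _ _ _).trans decide_eq_true_iff.symm
  · exact (h.traceForm_eq_zero_iff hv _ _ _ _).trans decide_eq_true_iff.symm
  · exact (h.traceForm_eq_zero_iff hv _ _ _ _).trans decide_eq_true_iff.symm
  · exact (h.traceForm_eq_zero_iff hv _ _ _ _).trans decide_eq_true_iff.symm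
  · exact (h.traceForm_mul_iff hv 2 1 (-1) 0 0).trans decide_eq_true_iff.symm
  · exact (h.traceForm_mul_iff hv 4 1 (-1) 0 0).trans decide_eq_true_iff.symm

theorem not_algIso_dTable (hv : IsAdapted (parityRev 𝒜) v) {n n' : Fin 28} (hn : n ≠ n') :
    ¬ AlgIso 𝒜 (shift 𝒜 (dTable v n)) (shift 𝒜 (dTable v n')) := by
  intro h
  refine hn (invariantConst_injective (funext fun i => ?_))
  rw [Bool.eq_iff_iff, ← (hv.hasConstants_shift n).invariant_iff hv,
    ← (hv.hasConstants_shift n').invariant_iff hv]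
  exact h.invariant_iff i

end Invariants

/-! ### Bases of the even part and adapted bases. -/

section EvenPair

variable {A : Type*} [AddCommGroup A] [Module ℂ A]

/-- `x` and `y` are linearly independent even elements. -/
structure EvenPair (𝒜 : ZMod 2 → Submodule ℂ A) (x y : A) : Prop where
  left_mem : x ∈ 𝒜 0
  right_mem : y ∈ 𝒜 0
  indep : ∀ p q : ℂ, p • x + q • y = 0 → p = 0 ∧ q = 0

variable {𝒜 : ZMod 2 → Submodule ℂ A} {x y : A}

theorem EvenPair.eq_and_eq (h : EvenPair 𝒜 x y) {p q p' q' : ℂ}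
    (hpq : p • x + q • y = p' • x + q' • y) : p = p' ∧ q = q' := by
  have h0 := h.indep (p - p') (q - q') (by
    rw [← sub_eq_zero.2 hpq]
    module)
  exact ⟨sub_eq_zero.1 h0.1, sub_eq_zero.1 h0.2⟩

theorem EvenPair.linearComb (h : EvenPair 𝒜 x y) {a b c d : ℂ} (hdet : a * d - b * c ≠ 0) :
    EvenPair 𝒜 (a • x + b • y) (c • x + d • y) where
  left_mem := add_mem (Submodule.smul_mem _ _ h.left_mem) (Submodule.smul_mem _ _ h.right_mem)
  right_mem := add_mem (Submodule.smul_mem _ _ h.left_mem) (Submodule.smul_mem _ _ h.right_mem)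
  indep p q hpq := by
    obtain ⟨h₁, h₂⟩ := h.indep (p * a + q * c) (p * b + q * d) (by rw [← hpq]; module)
    constructor
    · refine (mul_eq_zero.1 ?_).resolve_right hdet
      linear_combination d * h₁ - c * h₂
    · refine (mul_eq_zero.1 ?_).resolve_right hdet
      linear_combination a * h₂ - b * h₁

theorem EvenPair.swap (h : EvenPair 𝒜 x y) : EvenPair 𝒜 y x where
  left_mem := h.right_mem
  right_mem := h.left_mem
  indep p q hpq := (h.indep q p (by rw [← hpq, add_comm])).symm

theorem EvenPair.smul (h : EvenPair 𝒜 x y) {a d : ℂ} (ha : a ≠ 0) (hd : d ≠ 0) :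
    EvenPair 𝒜 (a • x) (d • y) := by
  simpa using h.linearComb (a := a) (b := 0) (c := 0) (d := d) (by simp [ha, hd])

theorem EvenPair.neg_neg (h : EvenPair 𝒜 x y) : EvenPair 𝒜 (-x) (-y) := by
  simpa using h.smul (a := -1) (d := -1) (by simp) (by simp)

theorem EvenPair.neg_right (h : EvenPair 𝒜 x y) : EvenPair 𝒜 x (-y) := by
  simpa using h.smul (a := 1) (d := -1) (by simp) (by simp)

theorem EvenPair.exists_coords (h_even : Module.finrank ℂ (𝒜 0) = 2) (h : EvenPair 𝒜 x y)
    {a : A} (ha : a ∈ 𝒜 0) : ∃ p q : ℂ, a = p • x + q • y := by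
  let f : Fin 2 → 𝒜 0 := ![⟨x, h.left_mem⟩, ⟨y, h.right_mem⟩]
  have hf : LinearIndependent ℂ f := by
    refine LinearIndependent.pair_iff.2 fun p q hpq => h.indep p q ?_
    simpa using congrArg Subtype.val hpq
  let b := basisOfLinearIndependentOfCardEqFinrank hf (by simp [h_even])
  have hb := congrArg Subtype.val (b.sum_repr ⟨a, ha⟩)
  refine ⟨b.repr ⟨a, ha⟩ 0, b.repr ⟨a, ha⟩ 1, ?_⟩
  simpa [b, f, Fin.sum_univ_two] using hb.symm

theorem exists_evenPair (h_even : Module.finrank ℂ (𝒜 0) = 2) : ∃ x y, EvenPair 𝒜 x y := by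
  have : Module.Finite ℂ (𝒜 0) := Module.finite_of_finrank_eq_succ h_even
  have b := Module.finBasisOfFinrankEq ℂ (𝒜 0) h_even
  have hb := b.linearIndependent
  refine ⟨b 0, b 1, (b 0).2, (b 1).2, fun p q hpq => ?_⟩
  have := Fintype.linearIndependent_iff.1 hb ![p, q] (by
    ext
    simpa [Fin.sum_univ_two] using hpq)
  exact ⟨this 0, this 1⟩

theorem exists_evenPair_of_ne_zero (h_even : Module.finrank ℂ (𝒜 0) = 2) {u : A}
    (hu : u ∈ 𝒜 0) (hu0 : u ≠ 0) : ∃ y, EvenPair 𝒜 u y := by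
  obtain ⟨x, y, h⟩ := exists_evenPair h_even
  obtain ⟨p, q, rfl⟩ := h.exists_coords h_even hu
  by_cases hp : p = 0
  · have hq : q ≠ 0 := by
      rintro rfl
      simp [hp] at hu0
    refine ⟨x, ?_⟩
    simpa using h.linearComb (a := p) (b := q) (c := 1) (d := 0) (by simpa using hq)
  · refine ⟨y, ?_⟩
    simpa using h.linearComb (a := p) (b := q) (c := 0) (d := 1) (by simpa using hp)

theorem exists_adapted [DirectSum.Decomposition 𝒜] (h_even : Module.finrank ℂ (𝒜 0) = 2)
    (h_odd : Module.finrank ℂ (𝒜 1) = 1) (h : EvenPair 𝒜 x y) {e : A} (he : e ∈ 𝒜 1)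
    (he0 : e ≠ 0) :
    ∃ v : Module.Basis (Fin 3) ℂ A, IsAdapted (parityRev 𝒜) v ∧ ∀ i, v i = ![e, x, y] i := by
  have hli : LinearIndependent ℂ ![e, x, y] := by
    refine Fintype.linearIndependent_iff.2 fun g hg => ?_
    simp only [Fin.sum_univ_three, Matrix.cons_val] at hg
    -- Applying the parity operator to a relation changes the sign of its odd part only, so the
    -- relation splits into an odd and an even one.
    have hg' := congrArg (parityOp 𝒜) hg
    simp only [map_add, map_smul, parityOp_odd 𝒜 he, parityOp_even 𝒜 h.left_mem,
      parityOp_even 𝒜 h.right_mem, map_zero] at hg'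
    have h₀ : (2 * g 0) • e = 0 := by
      rw [← sub_eq_zero.2 (hg.trans hg'.symm)]
      module
    have h₁ : (2 * g 1) • x + (2 * g 2) • y = 0 := by
      rw [← add_zero (0 : A)]
      nth_rw 1 [← hg]
      rw [← hg']
      module
    have h₀' : g 0 = 0 := by simpa [he0] using h₀
    obtain ⟨h₁', h₂'⟩ := h.indep _ _ h₁
    intro i
    fin_cases i
    · exact h₀'
    · simpa using h₁'
    · simpa using h₂'
  have hspan : ⊤ ≤ Submodule.span ℂ (Set.range ![e, x, y]) := by
    intro a _
    obtain ⟨a₀, ha₀, a₁, ha₁, rfl⟩ := exists_even_add_odd 𝒜 a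
    obtain ⟨p, q, rfl⟩ := h.exists_coords h_even ha₀
    obtain ⟨t, ht⟩ := exists_smul_eq_of_finrank_eq_one h_odd (x := ⟨e, he⟩)
      (by simpa using he0) ⟨a₁, ha₁⟩
    have ht' : t • e = a₁ := congrArg Subtype.val ht
    have hmem : ∀ i, ![e, x, y] i ∈ Submodule.span ℂ (Set.range ![e, x, y]) :=
      fun i => Submodule.subset_span ⟨i, rfl⟩
    rw [← ht']
    exact add_mem (add_mem (Submodule.smul_mem _ _ (hmem 1)) (Submodule.smul_mem _ _ (hmem 2)))
      (Submodule.smul_mem _ _ (hmem 0))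
  refine ⟨Module.Basis.mk hli hspan, ?_, fun i => by simp⟩
  rw [IsAdapted, Module.Basis.mk_apply, Module.Basis.mk_apply, Module.Basis.mk_apply]
  exact ⟨he, h.left_mem, h.right_mem⟩

end EvenPair

/-! ### Matching tables, and the equations forced by associativity. -/

section Classification

variable {A : Type*} [AddCommGroup A] [Module ℂ A]
  {𝒜 : ZMod 2 → Submodule ℂ A} [DirectSum.Decomposition 𝒜]

/-- In some adapted basis, `m` has the same structure constants as the `n`-th algebra. -/
def Realizes (𝒜 : ZMod 2 → Submodule ℂ A) (m : A →ₗ[ℂ] A →ₗ[ℂ] A) (n : Fin 28) : Prop :=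
  ∃ v : Module.Basis (Fin 3) ℂ A, IsAdapted (parityRev 𝒜) v ∧ HasConstants v m (algConst n)

theorem realizes_of_products (h_even : Module.finrank ℂ (𝒜 0) = 2)
    (h_odd : Module.finrank ℂ (𝒜 1) = 1) {m : A →ₗ[ℂ] A →ₗ[ℂ] A} {e x y : A} (h : EvenPair 𝒜 x y)
    (he : e ∈ 𝒜 1) (he0 : e ≠ 0) (n : Fin 28)
    (hm : ∀ i j, m (![e, x, y] i) (![e, x, y] j) =
      ∑ k, (algConst n i j k : ℂ) • ![e, x, y] k) : Realizes 𝒜 m n := by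
  obtain ⟨v, hv, hv'⟩ := exists_adapted h_even h_odd h he he0
  exact ⟨v, hv, fun i j => by simpa only [hv'] using hm i j⟩

end Classification

section Classification

variable {A : Type*} [AddCommGroup A] [Module ℂ A]
  {𝒜 : ZMod 2 → Submodule ℂ A}

theorem exists_odd_ne_zero (h_odd : Module.finrank ℂ (𝒜 1) = 1) : ∃ e ∈ 𝒜 1, e ≠ 0 := by
  obtain ⟨⟨e, he⟩, he0, -⟩ := finrank_eq_one_iff'.1 h_odd
  exact ⟨e, he, by simpa using he0⟩

theorem exists_odd_coord (h_odd : Module.finrank ℂ (𝒜 1) = 1) {e a : A} (he : e ∈ 𝒜 1)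
    (he0 : e ≠ 0) (ha : a ∈ 𝒜 1) : ∃ t : ℂ, a = t • e := by
  obtain ⟨t, ht⟩ := exists_smul_eq_of_finrank_eq_one h_odd (x := ⟨e, he⟩)
    (by simpa using he0) ⟨a, ha⟩
  exact ⟨t, (congrArg Subtype.val ht).symm⟩

theorem eq_zero_or_eq_one_of_eq_mul_self {l : ℂ} (h : l = l * l) : l = 0 ∨ l = 1 := by
  by_cases hl : l = 0
  · exact Or.inl hl
  · exact Or.inr (mul_left_cancel₀ hl (by rw [← h, mul_one]))

/-- Replacing e by te multiplies ee by t², so a nonzero coefficient of ee can be normalised to any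
nonzero c. -/
theorem exists_mul_self_mul_eq_one {σ : ℂ} (hσ : σ ≠ 0) (c : ℂ) (hc : c ≠ 0) :
    ∃ t : ℂ, t ≠ 0 ∧ t * (t * σ) = c := by
  obtain ⟨t, ht⟩ := IsAlgClosed.exists_eq_mul_self (c * σ⁻¹)
  refine ⟨t, ?_, ?_⟩
  · rintro rfl
    simp [hσ, hc] at ht
  · rw [← mul_assoc, ← ht]
    field_simp

/-- This compares (ex)e with e(xe): the left and right actions on e agree as soon as ee ≠ 0. -/
theorem IsGradedAssoc.left_smul_eq_right_smul {m : A →ₗ[ℂ] A →ₗ[ℂ] A} (hm : IsGradedAssoc 𝒜 m)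
    {e x : A} {l r : ℂ} (hl : m x e = l • e) (hr : m e x = r • e) :
    l • m e e = r • m e e := by
  have := hm.assoc e x e
  simpa [hl, hr] using this.symm

/-- The equations that associativity imposes on the products with an odd element `e`, in terms of
the products of two even basis elements. -/
theorem IsGradedAssoc.exists_scalars {m : A →ₗ[ℂ] A →ₗ[ℂ] A} (hm : IsGradedAssoc 𝒜 m)
    (h_even : Module.finrank ℂ (𝒜 0) = 2) (h_odd : Module.finrank ℂ (𝒜 1) = 1) {e x y : A}
    (h : EvenPair 𝒜 x y) (he : e ∈ 𝒜 1) (he0 : e ≠ 0) {a a' b b' c c' d d' : ℂ}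
    (hxx : m x x = a • x + a' • y) (hxy : m x y = b • x + b' • y)
    (hyx : m y x = c • x + c' • y) (hyy : m y y = d • x + d' • y) :
    ∃ lx ly rx ry σ τ : ℂ, m x e = lx • e ∧ m y e = ly • e ∧ m e x = rx • e ∧ m e y = ry • e ∧
      m e e = σ • x + τ • y ∧
      (a * lx + a' * ly = lx * lx ∧ b * lx + b' * ly = lx * ly ∧
        c * lx + c' * ly = ly * lx ∧ d * lx + d' * ly = ly * ly) ∧
      (a * rx + a' * ry = rx * rx ∧ b * rx + b' * ry = rx * ry ∧
        c * rx + c' * ry = ry * rx ∧ d * rx + d' * ry = ry * ry) ∧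
      (σ * a + τ * b = lx * σ ∧ σ * a' + τ * b' = lx * τ) ∧
      (σ * c + τ * d = ly * σ ∧ σ * c' + τ * d' = ly * τ) ∧
      (σ * a + τ * c = rx * σ ∧ σ * a' + τ * c' = rx * τ) ∧
      (σ * b + τ * d = ry * σ ∧ σ * b' + τ * d' = ry * τ) ∧
      (lx * σ = rx * σ ∧ lx * τ = rx * τ) ∧ (ly * σ = ry * σ ∧ ly * τ = ry * τ) := by
  obtain ⟨lx, hxe⟩ := exists_odd_coord h_odd he he0
    (by simpa using hm.graded 0 1 x h.left_mem e he)
  obtain ⟨ly, hye⟩ := exists_odd_coord h_odd he he0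
    (by simpa using hm.graded 0 1 y h.right_mem e he)
  obtain ⟨rx, hex⟩ := exists_odd_coord h_odd he he0
    (by simpa using hm.graded 1 0 e he x h.left_mem)
  obtain ⟨ry, hey⟩ := exists_odd_coord h_odd he he0
    (by simpa using hm.graded 1 0 e he y h.right_mem)
  obtain ⟨σ, τ, hee⟩ := h.exists_coords h_even (hm.graded 1 1 e he e he)
  have cancel : ∀ {p q : ℂ}, p • e = q • e → p = q := fun hpq =>
    smul_left_injective ℂ he0 hpq
  refine ⟨lx, ly, rx, ry, σ, τ, hxe, hye, hex, hey, hee, ⟨?_, ?_, ?_, ?_⟩, ⟨?_, ?_, ?_, ?_⟩,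
    h.eq_and_eq ?_, h.eq_and_eq ?_, h.eq_and_eq ?_, h.eq_and_eq ?_,
    h.eq_and_eq ?_, h.eq_and_eq ?_⟩
  · have := hm.assoc x x e
    simp only [hxx, hxe, hye, map_add, map_smul, LinearMap.add_apply, LinearMap.smul_apply,
      smul_smul, ← add_smul] at this
    exact cancel this
  · have := hm.assoc x y e
    simp only [hxy, hxe, hye, map_add, map_smul, LinearMap.add_apply, LinearMap.smul_apply,
      smul_smul, ← add_smul] at this
    rw [cancel this, mul_comm]
  · have := hm.assoc y x e
    simp only [hyx, hxe, hye, map_add, map_smul, LinearMap.add_apply, LinearMap.smul_apply,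
      smul_smul, ← add_smul] at this
    rw [cancel this, mul_comm]
  · have := hm.assoc y y e
    simp only [hyy, hxe, hye, map_add, map_smul, LinearMap.add_apply, LinearMap.smul_apply,
      smul_smul, ← add_smul] at this
    exact cancel this
  · have := hm.assoc e x x
    simp only [hxx, hex, hey, map_add, map_smul, LinearMap.smul_apply,
      smul_smul, ← add_smul] at this
    exact (cancel this).symm
  · have := hm.assoc e x y
    simp only [hxy, hex, hey, map_add, map_smul, LinearMap.smul_apply,
      smul_smul, ← add_smul] at this
    exact (cancel this).symm
  · have := hm.assoc e y x
    simp only [hyx, hex, hey, map_add, map_smul, LinearMap.smul_apply,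
      smul_smul, ← add_smul] at this
    exact (cancel this).symm
  · have := hm.assoc e y y
    simp only [hyy, hex, hey, map_add, map_smul, LinearMap.smul_apply,
      smul_smul, ← add_smul] at this
    exact (cancel this).symm
  · have := hm.assoc x e e
    simp only [hxx, hxy, hxe, hee, map_add, map_smul, LinearMap.smul_apply] at this
    exact Eq.trans (by module) (this.symm.trans (by module))
  · have := hm.assoc y e e
    simp only [hyx, hyy, hye, hee, map_add, map_smul, LinearMap.smul_apply] at this
    exact Eq.trans (by module) (this.symm.trans (by module))
  · have := hm.assoc e e x
    simp only [hxx, hyx, hex, hee, map_add, map_smul, LinearMap.add_apply,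
      LinearMap.smul_apply] at this
    exact Eq.trans (by module) (this.trans (by module))
  · have := hm.assoc e e y
    simp only [hxy, hyy, hey, hee, map_add, map_smul, LinearMap.add_apply,
      LinearMap.smul_apply] at this
    exact Eq.trans (by module) (this.trans (by module))
  · have := hm.left_smul_eq_right_smul hxe hex
    simpa [hee, smul_smul] using this
  · have := hm.left_smul_eq_right_smul hye hey
    simpa [hee, smul_smul] using this

end Classification

/-- These are the multiplicative functionals on ℂ × ℂ: zero and the two coordinate projections. -/
theorem orthogonal_idempotent_cases {p q : ℂ} (hp : p = p * p) (hpq : 0 = p * q)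
    (hq : q = q * q) : (p = 0 ∧ q = 0) ∨ (p = 1 ∧ q = 0) ∨ (p = 0 ∧ q = 1) := by
  rcases eq_zero_or_eq_one_of_eq_mul_self hp with rfl | rfl
  · rcases eq_zero_or_eq_one_of_eq_mul_self hq with rfl | rfl <;> simp
  · simpa using hpq.symm

/-! ### Case analysis by the type of the even part. -/

section Classification

variable {A : Type*} [AddCommGroup A] [Module ℂ A]
  {𝒜 : ZMod 2 → Submodule ℂ A} [DirectSum.Decomposition 𝒜]

/-- The even part is `ℂ × ℂ`. -/
theorem exists_realizes_of_split {m : A →ₗ[ℂ] A →ₗ[ℂ] A} (hm : IsGradedAssoc 𝒜 m)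
    (h_even : Module.finrank ℂ (𝒜 0) = 2) (h_odd : Module.finrank ℂ (𝒜 1) = 1) {x y : A}
    (h : EvenPair 𝒜 x y) (hxx : m x x = x) (hxy : m x y = 0) (hyx : m y x = 0)
    (hyy : m y y = y) : ∃ n, Realizes 𝒜 m n := by
  obtain ⟨e, he, he0⟩ := exists_odd_ne_zero h_odd
  obtain ⟨lx, ly, rx, ry, σ, τ, hxe, hye, hex, hey, hee, ⟨l₁, l₂, -, l₄⟩, ⟨r₁, r₂, -, r₄⟩,
    ⟨s₁, s₂⟩, ⟨s₃, s₄⟩, ⟨s₅, s₆⟩, ⟨s₇, s₈⟩, -, -⟩ :=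
    hm.exists_scalars (a := 1) (a' := 0) (b := 0) (b' := 0) (c := 0) (c' := 0) (d := 0) (d' := 1)
      h_even h_odd h he he0
      (by simp [hxx]) (by simp [hxy]) (by simp [hyx]) (by simp [hyy])
  simp only [one_mul, zero_mul, add_zero, zero_add] at l₁ l₂ l₄ r₁ r₂ r₄
  simp only [mul_one, mul_zero, add_zero, zero_add] at s₁ s₂ s₃ s₄ s₅ s₆ s₇ s₈
  by_cases hσ : σ = 0
  · by_cases hτ : τ = 0
    · subst hσ hτ
      rw [zero_smul, zero_smul, add_zero] at hee
      have hl : (lx = 0 ∧ ly = 0) ∨ (lx = 1 ∧ ly = 0) ∨ (lx = 0 ∧ ly = 1) :=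
        orthogonal_idempotent_cases l₁ l₂ l₄
      have hr : (rx = 0 ∧ ry = 0) ∨ (rx = 1 ∧ ry = 0) ∨ (rx = 0 ∧ ry = 1) :=
        orthogonal_idempotent_cases r₁ r₂ r₄
      clear l₁ l₂ l₄ r₁ r₂ r₄ s₁ s₂ s₃ s₄ s₅ s₆ s₇ s₈
      -- The shift changes the sign of products of vectors of A₀, so an idempotent x of A appears in
      -- the tables as -x. Exchanging x and y identifies cases that differ only by this symmetry.
      have direct := realizes_of_products (m := m) h_even h_odd h.neg_neg he he0
      have swapped := realizes_of_products (m := m) h_even h_odd h.swap.neg_neg he he0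
      rcases hl with ⟨rfl, rfl⟩ | ⟨rfl, rfl⟩ | ⟨rfl, rfl⟩ <;>
      rcases hr with ⟨rfl, rfl⟩ | ⟨rfl, rfl⟩ | ⟨rfl, rfl⟩ <;>
      simp only [zero_smul, one_smul] at hxe hye hex hey
      -- Indices in `Fin 28` start at 0, so index 6 stands for d₇.
      · refine ⟨6, direct _ ?_⟩
        simp +decide [Fin.forall_fin_succ, Fin.sum_univ_three, algConst, dConst, elemConst,
          basisSign, hxx, hxy, hyx, hyy, hxe, hye, hex, hey, hee]
      · refine ⟨2, direct _ ?_⟩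
        simp +decide [Fin.forall_fin_succ, Fin.sum_univ_three, algConst, dConst, elemConst,
          basisSign, hxx, hxy, hyx, hyy, hxe, hye, hex, hey, hee]
      · refine ⟨2, swapped _ ?_⟩
        simp +decide [Fin.forall_fin_succ, Fin.sum_univ_three, algConst, dConst, elemConst,
          basisSign, hxx, hxy, hyx, hyy, hxe, hye, hex, hey, hee]
      · refine ⟨3, direct _ ?_⟩
        simp +decide [Fin.forall_fin_succ, Fin.sum_univ_three, algConst, dConst, elemConst,
          basisSign, hxx, hxy, hyx, hyy, hxe, hye, hex, hey, hee]
      · refine ⟨5, direct _ ?_⟩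
        simp +decide [Fin.forall_fin_succ, Fin.sum_univ_three, algConst, dConst, elemConst,
          basisSign, hxx, hxy, hyx, hyy, hxe, hye, hex, hey, hee]
      · refine ⟨4, direct _ ?_⟩
        simp +decide [Fin.forall_fin_succ, Fin.sum_univ_three, algConst, dConst, elemConst,
          basisSign, hxx, hxy, hyx, hyy, hxe, hye, hex, hey, hee]
      · refine ⟨3, swapped _ ?_⟩
        simp +decide [Fin.forall_fin_succ, Fin.sum_univ_three, algConst, dConst, elemConst,
          basisSign, hxx, hxy, hyx, hyy, hxe, hye, hex, hey, hee]
      · refine ⟨4, swapped _ ?_⟩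
        simp +decide [Fin.forall_fin_succ, Fin.sum_univ_three, algConst, dConst, elemConst,
          basisSign, hxx, hxy, hyx, hyy, hxe, hye, hex, hey, hee]
      · refine ⟨5, swapped _ ?_⟩
        simp +decide [Fin.forall_fin_succ, Fin.sum_univ_three, algConst, dConst, elemConst,
          basisSign, hxx, hxy, hyx, hyy, hxe, hye, hex, hey, hee]
    · subst hσ
      obtain rfl : ly = 1 := mul_right_cancel₀ hτ (by rw [← s₄, one_mul])
      obtain rfl : ry = 1 := mul_right_cancel₀ hτ (by rw [← s₈, one_mul])
      obtain rfl : lx = 0 := by simpa using l₂.symm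
      obtain rfl : rx = 0 := by simpa using r₂.symm
      -- Rescaling e makes ee = y. The vector y is the third basis vector and keeps its sign, since
      -- d₁ contains -ψ₃³³.
      obtain ⟨t, ht, htτ⟩ := exists_mul_self_mul_eq_one hτ 1 one_ne_zero
      simp only [zero_smul, one_smul, zero_add] at hxe hye hex hey hee
      refine ⟨0, realizes_of_products h_even h_odd (h.swap.neg_right.swap) (e := t • e)
        (Submodule.smul_mem _ _ he) (smul_ne_zero ht he0) _ ?_⟩
      simp +decide [Fin.forall_fin_succ, Fin.sum_univ_three, algConst, dConst, elemConst,
          basisSign, hxx, hxy, hyx, hyy, hxe, hye, hex, hey, hee, smul_smul, htτ]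
  · obtain rfl : lx = 1 := mul_right_cancel₀ hσ (by rw [← s₁, one_mul])
    obtain rfl : rx = 1 := mul_right_cancel₀ hσ (by rw [← s₅, one_mul])
    obtain rfl : ly = 0 := by simpa using l₂.symm
    obtain rfl : ry = 0 := by simpa using r₂.symm
    obtain rfl : τ = 0 := by simpa using s₄
    obtain ⟨t, ht, htσ⟩ := exists_mul_self_mul_eq_one hσ 1 one_ne_zero
    simp only [zero_smul, one_smul, add_zero] at hxe hye hex hey hee
    refine ⟨0, realizes_of_products h_even h_odd (h.neg_right.swap) (e := t • e)
      (Submodule.smul_mem _ _ he) (smul_ne_zero ht he0) _ ?_⟩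
    simp +decide [Fin.forall_fin_succ, Fin.sum_univ_three, algConst, dConst, elemConst,
        basisSign, hxx, hxy, hyx, hyy, hxe, hye, hex, hey, hee, smul_smul, htσ]

/-- The even part is `ℂ x ⊕ ℂ y` with `x` idempotent and `y` annihilating everything. -/
theorem exists_realizes_of_null_complement {m : A →ₗ[ℂ] A →ₗ[ℂ] A} (hm : IsGradedAssoc 𝒜 m)
    (h_even : Module.finrank ℂ (𝒜 0) = 2) (h_odd : Module.finrank ℂ (𝒜 1) = 1) {x y : A}
    (h : EvenPair 𝒜 x y) (hxx : m x x = x) (hxy : m x y = 0) (hyx : m y x = 0)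
    (hyy : m y y = 0) : ∃ n, Realizes 𝒜 m n := by
  obtain ⟨e, he, he0⟩ := exists_odd_ne_zero h_odd
  obtain ⟨lx, ly, rx, ry, σ, τ, hxe, hye, hex, hey, hee, ⟨l₁, l₂, -, l₄⟩, ⟨r₁, r₂, -, r₄⟩,
    ⟨s₁, s₂⟩, ⟨s₃, s₄⟩, ⟨s₅, s₆⟩, ⟨s₇, s₈⟩, -, -⟩ :=
    hm.exists_scalars (a := 1) (a' := 0) (b := 0) (b' := 0) (c := 0) (c' := 0) (d := 0) (d' := 0)
      h_even h_odd h he he0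
      (by simp [hxx]) (by simp [hxy]) (by simp [hyx]) (by simp [hyy])
  simp only [one_mul, zero_mul, mul_one, mul_zero, add_zero] at l₁ l₄ r₁ r₄ s₁ s₂
  simp only [mul_one, mul_zero, add_zero] at s₅ s₆
  obtain rfl : ly = 0 := mul_self_eq_zero.1 l₄.symm
  obtain rfl : ry = 0 := mul_self_eq_zero.1 r₄.symm
  by_cases hσ : σ = 0
  · subst hσ
    by_cases hτ : τ = 0
    · subst hτ
      have direct := realizes_of_products (m := m) h_even h_odd h.neg_neg.swap he he0
      rcases eq_zero_or_eq_one_of_eq_mul_self l₁ with rfl | rfl <;>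
      rcases eq_zero_or_eq_one_of_eq_mul_self r₁ with rfl | rfl <;>
      simp only [zero_smul, one_smul, add_zero] at hxe hye hex hey hee
      · refine ⟨24, direct _ ?_⟩
        simp +decide [Fin.forall_fin_succ, Fin.sum_univ_three, algConst, dConst, elemConst,
          basisSign, hxx, hxy, hyx, hyy, hxe, hye, hex, hey, hee]
      · refine ⟨20, direct _ ?_⟩
        simp +decide [Fin.forall_fin_succ, Fin.sum_univ_three, algConst, dConst, elemConst,
          basisSign, hxx, hxy, hyx, hyy, hxe, hye, hex, hey, hee]
      · refine ⟨21, direct _ ?_⟩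
        simp +decide [Fin.forall_fin_succ, Fin.sum_univ_three, algConst, dConst, elemConst,
          basisSign, hxx, hxy, hyx, hyy, hxe, hye, hex, hey, hee]
      · refine ⟨22, direct _ ?_⟩
        simp +decide [Fin.forall_fin_succ, Fin.sum_univ_three, algConst, dConst, elemConst,
          basisSign, hxx, hxy, hyx, hyy, hxe, hye, hex, hey, hee]
    · obtain rfl : lx = 0 := by simpa [hτ] using s₂
      obtain rfl : rx = 0 := by simpa [hτ] using s₆
      simp only [zero_smul, zero_add] at hxe hye hex hey hee
      -- Since y is determined only up to a scalar here, τy = ee serves as second basis vector and e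
      -- needs no rescaling.
      refine ⟨8, realizes_of_products h_even h_odd
        ((h.smul (neg_ne_zero.2 one_ne_zero) hτ).swap) he he0 _ ?_⟩
      simp +decide [Fin.forall_fin_succ, Fin.sum_univ_three, algConst, dConst, elemConst,
        basisSign, hxx, hxy, hyx, hyy, hxe, hye, hex, hey, hee]
  · obtain rfl : lx = 1 := mul_right_cancel₀ hσ (by rw [← s₁, one_mul])
    obtain rfl : rx = 1 := mul_right_cancel₀ hσ (by rw [← s₅, one_mul])
    obtain rfl : τ = 0 := by simpa using s₂.symm
    obtain ⟨t, ht, htσ⟩ := exists_mul_self_mul_eq_one hσ 1 one_ne_zero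
    simp only [zero_smul, one_smul, add_zero] at hxe hye hex hey hee
    refine ⟨1, realizes_of_products h_even h_odd h.swap (e := t • e)
      (Submodule.smul_mem _ _ he) (smul_ne_zero ht he0) _ ?_⟩
    simp +decide [Fin.forall_fin_succ, Fin.sum_univ_three, algConst, dConst, elemConst,
        basisSign, hxx, hxy, hyx, hyy, hxe, hye, hex, hey, hee, smul_smul, htσ]

/-- The even part is the algebra of dual numbers. -/
theorem exists_realizes_of_dual_numbers {m : A →ₗ[ℂ] A →ₗ[ℂ] A} (hm : IsGradedAssoc 𝒜 m)
    (h_even : Module.finrank ℂ (𝒜 0) = 2) (h_odd : Module.finrank ℂ (𝒜 1) = 1) {x y : A}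
    (h : EvenPair 𝒜 x y) (hxx : m x x = x) (hxy : m x y = y) (hyx : m y x = y)
    (hyy : m y y = 0) : ∃ n, Realizes 𝒜 m n := by
  obtain ⟨e, he, he0⟩ := exists_odd_ne_zero h_odd
  obtain ⟨lx, ly, rx, ry, σ, τ, hxe, hye, hex, hey, hee, ⟨l₁, l₂, -, l₄⟩, ⟨r₁, r₂, -, r₄⟩,
    ⟨s₁, s₂⟩, ⟨s₃, s₄⟩, ⟨s₅, s₆⟩, ⟨s₇, s₈⟩, -, -⟩ :=
    hm.exists_scalars (a := 1) (a' := 0) (b := 0) (b' := 1) (c := 0) (c' := 1) (d := 0) (d' := 0)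
      h_even h_odd h he he0
      (by simp [hxx]) (by simp [hxy]) (by simp [hyx]) (by simp [hyy])
  simp only [one_mul, zero_mul, mul_one, mul_zero, add_zero, zero_add] at l₁ l₄ r₁ r₄ s₁ s₂
  simp only [mul_one, mul_zero, add_zero, zero_add] at s₄ s₅ s₆
  obtain rfl : ly = 0 := mul_self_eq_zero.1 l₄.symm
  obtain rfl : ry = 0 := mul_self_eq_zero.1 r₄.symm
  obtain rfl : σ = 0 := by simpa using s₄
  by_cases hτ : τ = 0
  · subst hτ
    have direct := realizes_of_products (m := m) h_even h_odd h.neg_neg.swap he he0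
    rcases eq_zero_or_eq_one_of_eq_mul_self l₁ with rfl | rfl <;>
    rcases eq_zero_or_eq_one_of_eq_mul_self r₁ with rfl | rfl <;>
    simp only [zero_smul, one_smul, add_zero] at hxe hye hex hey hee
    · refine ⟨19, direct _ ?_⟩
      simp +decide [Fin.forall_fin_succ, Fin.sum_univ_three, algConst, dConst, elemConst,
        basisSign, hxx, hxy, hyx, hyy, hxe, hye, hex, hey, hee]
    · refine ⟨17, direct _ ?_⟩
      simp +decide [Fin.forall_fin_succ, Fin.sum_univ_three, algConst, dConst, elemConst,
        basisSign, hxx, hxy, hyx, hyy, hxe, hye, hex, hey, hee]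
    · refine ⟨18, direct _ ?_⟩
      simp +decide [Fin.forall_fin_succ, Fin.sum_univ_three, algConst, dConst, elemConst,
        basisSign, hxx, hxy, hyx, hyy, hxe, hye, hex, hey, hee]
    · refine ⟨23, direct _ ?_⟩
      simp +decide [Fin.forall_fin_succ, Fin.sum_univ_three, algConst, dConst, elemConst,
        basisSign, hxx, hxy, hyx, hyy, hxe, hye, hex, hey, hee]
  · obtain rfl : lx = 1 := mul_right_cancel₀ hτ (by rw [← s₂, one_mul])
    obtain rfl : rx = 1 := mul_right_cancel₀ hτ (by rw [← s₆, one_mul])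
    simp only [zero_smul, one_smul, zero_add] at hxe hye hex hey hee
    refine ⟨7, realizes_of_products h_even h_odd
      ((h.smul (neg_ne_zero.2 one_ne_zero) hτ).swap) he he0 _ ?_⟩
    simp +decide [Fin.forall_fin_succ, Fin.sum_univ_three, algConst, dConst, elemConst,
      basisSign, hxx, hxy, hyx, hyy, hxe, hye, hex, hey, hee]

/-- In the even part, `x` is a left unit and `y` a left annihilator. -/
theorem exists_realizes_of_left_unit {m : A →ₗ[ℂ] A →ₗ[ℂ] A} (hm : IsGradedAssoc 𝒜 m)
    (h_even : Module.finrank ℂ (𝒜 0) = 2) (h_odd : Module.finrank ℂ (𝒜 1) = 1) {x y : A}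
    (h : EvenPair 𝒜 x y) (hxx : m x x = x) (hxy : m x y = y) (hyx : m y x = 0)
    (hyy : m y y = 0) : ∃ n, Realizes 𝒜 m n := by
  obtain ⟨e, he, he0⟩ := exists_odd_ne_zero h_odd
  obtain ⟨lx, ly, rx, ry, σ, τ, hxe, hye, hex, hey, hee, ⟨l₁, l₂, -, l₄⟩, ⟨r₁, r₂, -, r₄⟩,
    ⟨s₁, s₂⟩, ⟨s₃, s₄⟩, ⟨s₅, s₆⟩, ⟨s₇, s₈⟩, ⟨-, c₂⟩, -⟩ :=
    hm.exists_scalars (a := 1) (a' := 0) (b := 0) (b' := 1) (c := 0) (c' := 0) (d := 0) (d' := 0)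
      h_even h_odd h he he0
      (by simp [hxx]) (by simp [hxy]) (by simp [hyx]) (by simp [hyy])
  simp only [one_mul, zero_mul, mul_one, mul_zero, add_zero, zero_add] at l₁ l₄ r₁ r₄ s₁ s₂
  simp only [mul_one, mul_zero, add_zero] at s₄ s₅ s₆ s₈
  obtain rfl : ly = 0 := mul_self_eq_zero.1 l₄.symm
  obtain rfl : ry = 0 := mul_self_eq_zero.1 r₄.symm
  obtain rfl : σ = 0 := by simpa using s₈
  -- The element x fixes ee = τy from the left and kills it from the right, while its two actions on
  -- e agree if ee ≠ 0.
  obtain rfl : τ = 0 := by rw [s₂, c₂, ← s₆]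
  have direct := realizes_of_products (m := m) h_even h_odd h.neg_neg.swap he he0
  rcases eq_zero_or_eq_one_of_eq_mul_self l₁ with rfl | rfl <;>
  rcases eq_zero_or_eq_one_of_eq_mul_self r₁ with rfl | rfl <;>
  simp only [zero_smul, one_smul, add_zero] at hxe hye hex hey hee
  · refine ⟨16, direct _ ?_⟩
    simp +decide [Fin.forall_fin_succ, Fin.sum_univ_three, algConst, dConst, elemConst,
      basisSign, hxx, hxy, hyx, hyy, hxe, hye, hex, hey, hee]
  · refine ⟨12, direct _ ?_⟩
    simp +decide [Fin.forall_fin_succ, Fin.sum_univ_three, algConst, dConst, elemConst,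
      basisSign, hxx, hxy, hyx, hyy, hxe, hye, hex, hey, hee]
  · refine ⟨10, direct _ ?_⟩
    simp +decide [Fin.forall_fin_succ, Fin.sum_univ_three, algConst, dConst, elemConst,
      basisSign, hxx, hxy, hyx, hyy, hxe, hye, hex, hey, hee]
  · refine ⟨14, direct _ ?_⟩
    simp +decide [Fin.forall_fin_succ, Fin.sum_univ_three, algConst, dConst, elemConst,
      basisSign, hxx, hxy, hyx, hyy, hxe, hye, hex, hey, hee]

/-- In the even part, `x` is a right unit and `y` a right annihilator. -/
theorem exists_realizes_of_right_unit {m : A →ₗ[ℂ] A →ₗ[ℂ] A} (hm : IsGradedAssoc 𝒜 m)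
    (h_even : Module.finrank ℂ (𝒜 0) = 2) (h_odd : Module.finrank ℂ (𝒜 1) = 1) {x y : A}
    (h : EvenPair 𝒜 x y) (hxx : m x x = x) (hxy : m x y = 0) (hyx : m y x = y)
    (hyy : m y y = 0) : ∃ n, Realizes 𝒜 m n := by
  obtain ⟨e, he, he0⟩ := exists_odd_ne_zero h_odd
  obtain ⟨lx, ly, rx, ry, σ, τ, hxe, hye, hex, hey, hee, ⟨l₁, l₂, -, l₄⟩, ⟨r₁, r₂, -, r₄⟩,
    ⟨s₁, s₂⟩, ⟨s₃, s₄⟩, ⟨s₅, s₆⟩, ⟨s₇, s₈⟩, ⟨-, c₂⟩, -⟩ :=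
    hm.exists_scalars (a := 1) (a' := 0) (b := 0) (b' := 0) (c := 0) (c' := 1) (d := 0) (d' := 0)
      h_even h_odd h he he0
      (by simp [hxx]) (by simp [hxy]) (by simp [hyx]) (by simp [hyy])
  simp only [one_mul, zero_mul, mul_one, mul_zero, add_zero] at l₁ l₄ r₁ r₄ s₁ s₂
  simp only [mul_one, mul_zero, add_zero, zero_add] at s₄ s₅ s₆ s₈
  obtain rfl : ly = 0 := mul_self_eq_zero.1 l₄.symm
  obtain rfl : ry = 0 := mul_self_eq_zero.1 r₄.symm
  obtain rfl : σ = 0 := by simpa using s₄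
  obtain rfl : τ = 0 := by rw [s₆, ← c₂, ← s₂]
  have direct := realizes_of_products (m := m) h_even h_odd h.neg_neg.swap he he0
  rcases eq_zero_or_eq_one_of_eq_mul_self l₁ with rfl | rfl <;>
  rcases eq_zero_or_eq_one_of_eq_mul_self r₁ with rfl | rfl <;>
  simp only [zero_smul, one_smul, add_zero] at hxe hye hex hey hee
  · refine ⟨15, direct _ ?_⟩
    simp +decide [Fin.forall_fin_succ, Fin.sum_univ_three, algConst, dConst, elemConst,
      basisSign, hxx, hxy, hyx, hyy, hxe, hye, hex, hey, hee]
  · refine ⟨9, direct _ ?_⟩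
    simp +decide [Fin.forall_fin_succ, Fin.sum_univ_three, algConst, dConst, elemConst,
      basisSign, hxx, hxy, hyx, hyy, hxe, hye, hex, hey, hee]
  · refine ⟨11, direct _ ?_⟩
    simp +decide [Fin.forall_fin_succ, Fin.sum_univ_three, algConst, dConst, elemConst,
      basisSign, hxx, hxy, hyx, hyy, hxe, hye, hex, hey, hee]
  · refine ⟨13, direct _ ?_⟩
    simp +decide [Fin.forall_fin_succ, Fin.sum_univ_three, algConst, dConst, elemConst,
      basisSign, hxx, hxy, hyx, hyy, hxe, hye, hex, hey, hee]

/-- The even part is spanned by `x` and `y = x²`, with `x³ = 0`. -/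
theorem exists_realizes_of_nilpotent {m : A →ₗ[ℂ] A →ₗ[ℂ] A} (hm : IsGradedAssoc 𝒜 m)
    (h_even : Module.finrank ℂ (𝒜 0) = 2) (h_odd : Module.finrank ℂ (𝒜 1) = 1) {x y : A}
    (h : EvenPair 𝒜 x y) (hxx : m x x = y) (hxy : m x y = 0) (hyx : m y x = 0)
    (hyy : m y y = 0) : ∃ n, Realizes 𝒜 m n := by
  obtain ⟨e, he, he0⟩ := exists_odd_ne_zero h_odd
  obtain ⟨lx, ly, rx, ry, σ, τ, hxe, hye, hex, hey, hee, ⟨l₁, l₂, -, l₄⟩, ⟨r₁, r₂, -, r₄⟩,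
    ⟨s₁, s₂⟩, ⟨s₃, s₄⟩, ⟨s₅, s₆⟩, ⟨s₇, s₈⟩, -, -⟩ :=
    hm.exists_scalars (a := 0) (a' := 1) (b := 0) (b' := 0) (c := 0) (c' := 0) (d := 0) (d' := 0)
      h_even h_odd h he he0
      (by simp [hxx]) (by simp [hxy]) (by simp [hyx]) (by simp [hyy])
  simp only [one_mul, zero_mul, mul_one, mul_zero, add_zero, zero_add] at l₁ l₄ r₁ r₄ s₂
  obtain rfl : ly = 0 := mul_self_eq_zero.1 l₄.symm
  obtain rfl : ry = 0 := mul_self_eq_zero.1 r₄.symm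
  obtain rfl : lx = 0 := mul_self_eq_zero.1 l₁.symm
  obtain rfl : rx = 0 := mul_self_eq_zero.1 r₁.symm
  obtain rfl : σ = 0 := by simpa using s₂
  by_cases hτ : τ = 0
  · subst hτ
    simp only [zero_smul, add_zero] at hxe hye hex hey hee
    refine ⟨27, realizes_of_products h_even h_odd h.neg_right.swap he he0 _ ?_⟩
    simp +decide [Fin.forall_fin_succ, Fin.sum_univ_three, algConst, dConst, elemConst,
      basisSign, hxx, hxy, hyx, hyy, hxe, hye, hex, hey, hee]
  -- The value -1 comes from the sign of the second basis vector -y: both squares in d₂₆ must equal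
  -- it.
  · obtain ⟨t, ht, htτ⟩ := exists_mul_self_mul_eq_one hτ (-1) (by simp)
    simp only [zero_smul, zero_add] at hxe hye hex hey hee
    refine ⟨25, realizes_of_products h_even h_odd h.neg_right.swap (e := t • e)
      (Submodule.smul_mem _ _ he) (smul_ne_zero ht he0) _ ?_⟩
    simp +decide [Fin.forall_fin_succ, Fin.sum_univ_three, algConst, dConst, elemConst,
      basisSign, hxx, hxy, hyx, hyy, hxe, hye, hex, hey, hee, smul_smul, htτ]

/-- The product vanishes on the even part. -/
theorem exists_realizes_of_even_null {m : A →ₗ[ℂ] A →ₗ[ℂ] A} (hm : IsGradedAssoc 𝒜 m)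
    (h_even : Module.finrank ℂ (𝒜 0) = 2) (h_odd : Module.finrank ℂ (𝒜 1) = 1) (hm0 : m ≠ 0)
    (hzero : ∀ a ∈ 𝒜 0, ∀ b ∈ 𝒜 0, m a b = 0) : ∃ n, Realizes 𝒜 m n := by
  obtain ⟨e, he, he0⟩ := exists_odd_ne_zero h_odd
  have hl : ∀ a ∈ 𝒜 0, m a e = 0 := by
    intro a ha
    obtain ⟨l, hl⟩ := exists_odd_coord h_odd he he0
      (by simpa using hm.graded 0 1 a ha e he)
    have := hm.assoc a a e
    rw [hzero a ha a ha, hl, map_smul, hl] at this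
    simpa [hl, he0] using this.symm
  have hr : ∀ a ∈ 𝒜 0, m e a = 0 := by
    intro a ha
    obtain ⟨r, hr⟩ := exists_odd_coord h_odd he he0
      (by simpa using hm.graded 1 0 e he a ha)
    have := hm.assoc e a a
    rw [hzero a ha a ha, hr, map_smul, LinearMap.smul_apply, hr] at this
    simpa [hr, he0] using this
  -- A₀ annihilates itself and, since its elements square to zero, also e; thus ee is the only
  -- product left.
  have hee : m e e ≠ 0 := by
    intro hee
    apply hm0
    ext a b
    obtain ⟨a₀, ha₀, a₁, ha₁, rfl⟩ := exists_even_add_odd 𝒜 a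
    obtain ⟨b₀, hb₀, b₁, hb₁, rfl⟩ := exists_even_add_odd 𝒜 b
    obtain ⟨p, rfl⟩ := exists_odd_coord h_odd he he0 ha₁
    obtain ⟨q, rfl⟩ := exists_odd_coord h_odd he he0 hb₁
    simp [hee, hl a₀ ha₀, hr b₀ hb₀, hzero a₀ ha₀ b₀ hb₀]
  have hs : m e e ∈ 𝒜 0 := hm.graded 1 1 e he e he
  obtain ⟨y, h⟩ := exists_evenPair_of_ne_zero h_even hs hee
  have hy := h.right_mem
  refine ⟨26, realizes_of_products h_even h_odd h he he0 _ ?_⟩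
  simp +decide [Fin.forall_fin_succ, Fin.sum_univ_three, algConst, dConst, elemConst,
    basisSign, hl _ hs, hl _ hy, hr _ hs, hr _ hy, hzero _ hs _ hs, hzero _ hs _ hy,
    hzero _ hy _ hs, hzero _ hy _ hy]

end Classification

/-! ### Determination of the even part. -/

section Classification

variable {A : Type*} [AddCommGroup A] [Module ℂ A]
  {𝒜 : ZMod 2 → Submodule ℂ A}

theorem EvenPair.sub_smul_left {x y : A} (h : EvenPair 𝒜 x y) (κ : ℂ) :
    EvenPair 𝒜 x (y - κ • x) := by
  have := h.linearComb (a := 1) (b := 0) (c := -κ) (d := 1) (by simp)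
  rwa [one_smul, zero_smul, add_zero, neg_smul, one_smul, neg_add_eq_sub] at this

variable [DirectSum.Decomposition 𝒜]

/-- The even part has the unit `x`. -/
theorem exists_realizes_of_unital {m : A →ₗ[ℂ] A →ₗ[ℂ] A} (hm : IsGradedAssoc 𝒜 m)
    (h_even : Module.finrank ℂ (𝒜 0) = 2) (h_odd : Module.finrank ℂ (𝒜 1) = 1) {x y : A}
    (h : EvenPair 𝒜 x y) (hxx : m x x = x) (hxy : m x y = y) (hyx : m y x = y) :
    ∃ n, Realizes 𝒜 m n := by
  obtain ⟨α, β, hyy⟩ := h.exists_coords h_even (hm.graded 0 0 y h.right_mem y h.right_mem)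
  -- Completing the square: the unital algebra is generated by z with z² a multiple of x.
  set z : A := y - (β / 2) • x with hz
  have hxz : m x z = z := by simp [hz, hxx, hxy]
  have hzx : m z x = z := by simp [hz, hxx, hyx]
  obtain ⟨γ, hγ⟩ : ∃ γ : ℂ, m z z = γ • x := by
    refine ⟨α + β ^ 2 / 4, ?_⟩
    simp only [hz, map_sub, map_smul, LinearMap.sub_apply, LinearMap.smul_apply, hxx, hxy, hyx,
      hyy]
    module
  have hp : EvenPair 𝒜 x z := h.sub_smul_left _
  by_cases hγ0 : γ = 0
  · exact exists_realizes_of_dual_numbers hm h_even h_odd hp hxx hxz hzx (by simp [hγ, hγ0])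
  -- With s²γ = 1/4, the elements x/2 ± sz are orthogonal idempotents with sum x.
  · obtain ⟨s, hs, hsγ⟩ := exists_mul_self_mul_eq_one hγ0 (1 / 4) (by norm_num)
    have hprod : ∀ t t' : ℂ, m ((1 / 2 : ℂ) • x + t • z) ((1 / 2 : ℂ) • x + t' • z) =
        (1 / 4 + t * (t' * γ)) • x + ((t + t') / 2) • z := by
      intro t t'
      simp only [map_add, map_smul, LinearMap.add_apply, LinearMap.smul_apply, hxx, hxz, hzx, hγ]
      module
    have hpq := hp.linearComb (a := 1 / 2) (b := s) (c := 1 / 2) (d := -s) (by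
      rw [← sub_ne_zero]
      ring_nf
      simpa using hs)
    refine exists_realizes_of_split hm h_even h_odd hpq ?_ ?_ ?_ ?_
    · rw [hprod, hsγ]
      module
    · rw [hprod, neg_mul, mul_neg, hsγ]
      module
    · rw [hprod, neg_mul, hsγ]
      module
    · rw [hprod, neg_mul, neg_mul, mul_neg, hsγ]
      module

/-- The even part contains a nonzero idempotent. -/
theorem exists_realizes_of_idempotent {m : A →ₗ[ℂ] A →ₗ[ℂ] A} (hm : IsGradedAssoc 𝒜 m)
    (h_even : Module.finrank ℂ (𝒜 0) = 2) (h_odd : Module.finrank ℂ (𝒜 1) = 1) {u : A}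
    (hu : u ∈ 𝒜 0) (hu0 : u ≠ 0) (huu : m u u = u) : ∃ n, Realizes 𝒜 m n := by
  obtain ⟨y, h⟩ := exists_evenPair_of_ne_zero h_even hu hu0
  obtain ⟨a, b, huy⟩ := h.exists_coords h_even (hm.graded 0 0 u hu y h.right_mem)
  obtain ⟨c, d, hyu⟩ := h.exists_coords h_even (hm.graded 0 0 y h.right_mem u hu)
  -- Left and right multiplication by u are commuting idempotents; b and d are their eigenvalues on
  -- A₀ / ℂu. In each of the four cases y is corrected by a multiple of u to a common eigenvector.
  have h₁ : a + b * a = a ∧ b * b = b := h.eq_and_eq <| by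
    rw [← huy]
    conv_rhs => rw [← huu, hm.assoc, huy]
    simp only [map_add, map_smul, huu, huy]
    module
  have h₂ : c + d * c = c ∧ d * d = d := h.eq_and_eq <| by
    rw [← hyu]
    conv_rhs => rw [← huu, ← hm.assoc, hyu]
    simp only [map_add, map_smul, LinearMap.add_apply, LinearMap.smul_apply, huu, hyu]
    module
  have h₃ : a + b * c = c + d * a ∧ b * d = d * b := h.eq_and_eq <| by
    have := hm.assoc u y u
    simp only [huy, hyu, map_add, map_smul, LinearMap.add_apply, LinearMap.smul_apply,
      huu] at this
    exact Eq.trans (by module) (this.trans (by module))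
  rcases eq_zero_or_eq_one_of_eq_mul_self h₁.2.symm with rfl | rfl <;>
  rcases eq_zero_or_eq_one_of_eq_mul_self h₂.2.symm with rfl | rfl
  · obtain rfl : a = c := by simpa using h₃.1
    have hp := h.sub_smul_left a
    have huz : m u (y - a • u) = 0 := by simp [huu, huy]
    have hzu : m (y - a • u) u = 0 := by simp [huu, hyu]
    generalize y - a • u = z at hp huz hzu
    obtain ⟨α, β, hzz⟩ := hp.exists_coords h_even (hm.graded 0 0 z hp.right_mem z hp.right_mem)
    obtain rfl : α = 0 := by
      have := hm.assoc u z z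
      simpa [huz, hzz, huu, hu0] using this.symm
    rw [zero_smul, zero_add] at hzz
    by_cases hβ : β = 0
    · exact exists_realizes_of_null_complement hm h_even h_odd hp huu huz hzu
        (by simp [hzz, hβ])
    · have hp' := hp.smul one_ne_zero (inv_ne_zero hβ)
      rw [one_smul] at hp'
      exact exists_realizes_of_split hm h_even h_odd hp' huu (by simp [huz]) (by simp [hzu])
        (by simp [hzz, hβ])
  · obtain rfl : c = 0 := by simpa using h₂.1
    have hp := h.sub_smul_left a
    have huz : m u (y - a • u) = 0 := by simp [huu, huy]
    have hzu : m (y - a • u) u = y - a • u := by simp [huu, hyu]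
    generalize y - a • u = z at hp huz hzu
    refine exists_realizes_of_right_unit hm h_even h_odd hp huu huz hzu ?_
    have := hm.assoc z u z
    rwa [hzu, huz, map_zero] at this
  · obtain rfl : a = 0 := by simpa using h₁.1
    have hp := h.sub_smul_left c
    have huz : m u (y - c • u) = y - c • u := by simp [huu, huy]
    have hzu : m (y - c • u) u = 0 := by simp [huu, hyu]
    generalize y - c • u = z at hp huz hzu
    refine exists_realizes_of_left_unit hm h_even h_odd hp huu huz hzu ?_
    have := hm.assoc z u z
    rw [huz, hzu, map_zero, LinearMap.zero_apply] at this
    exact this.symm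
  · obtain rfl : a = 0 := by simpa using h₁.1
    obtain rfl : c = 0 := by simpa using h₂.1
    exact exists_realizes_of_unital hm h_even h_odd h huu (by simp [huy]) (by simp [hyu])

/-- Every nonzero graded algebra structure has one of the 28 tables in some adapted basis. -/
theorem exists_realizes {m : A →ₗ[ℂ] A →ₗ[ℂ] A} (hm : IsGradedAssoc 𝒜 m)
    (h_even : Module.finrank ℂ (𝒜 0) = 2) (h_odd : Module.finrank ℂ (𝒜 1) = 1) (hm0 : m ≠ 0) :
    ∃ n, Realizes 𝒜 m n := by
  by_cases hu : ∃ u ∈ 𝒜 0, u ≠ 0 ∧ m u u = u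
  · obtain ⟨u, hu, hu0, huu⟩ := hu
    exact exists_realizes_of_idempotent hm h_even h_odd hu hu0 huu
  push Not at hu
  have hmul : ∀ {a b : A}, a ∈ 𝒜 0 → b ∈ 𝒜 0 → m a b ∈ 𝒜 0 := fun ha hb =>
    hm.graded 0 0 _ ha _ hb
  by_cases hsq : ∀ a ∈ 𝒜 0, m a a = 0
  -- If all squares vanish, the product is anticommutative. Then x(xy) = (xx)y = 0 and (xy)y = x(yy)
  -- = 0 force xy = 0.
  · have hanti : ∀ a ∈ 𝒜 0, ∀ b ∈ 𝒜 0, m b a = -m a b := by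
      intro a ha b hb
      have := hsq (a + b) (add_mem ha hb)
      simp only [map_add, LinearMap.add_apply, hsq a ha, hsq b hb, zero_add, add_zero] at this
      exact eq_neg_of_add_eq_zero_left (by simpa [add_comm] using this)
    obtain ⟨x, y, h⟩ := exists_evenPair h_even
    obtain ⟨α, β, hxy⟩ := h.exists_coords h_even (hmul h.left_mem h.right_mem)
    have hxx := hsq x h.left_mem
    have hyy := hsq y h.right_mem
    have h₁ := hm.assoc x x y
    have h₂ := hm.assoc x y y
    have hxy0 : m x y = 0 := by
      by_contra hne
      have hβ : β = 0 := by
        rw [hxx, map_zero, LinearMap.zero_apply] at h₁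
        conv_rhs at h₁ => rw [hxy]
        rw [map_add, map_smul, map_smul, hxx, smul_zero, zero_add] at h₁
        exact (smul_eq_zero.1 h₁.symm).resolve_right hne
      have hα : α = 0 := by
        rw [hyy, map_zero] at h₂
        conv_lhs at h₂ => rw [hxy]
        rw [map_add, map_smul, map_smul, LinearMap.add_apply, LinearMap.smul_apply,
          LinearMap.smul_apply, hyy, smul_zero, add_zero] at h₂
        exact (smul_eq_zero.1 h₂).resolve_right hne
      exact hne (by simp [hxy, hα, hβ])
    have hyx0 : m y x = 0 := by rw [hanti x h.left_mem y h.right_mem, hxy0, neg_zero]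
    refine exists_realizes_of_even_null hm h_even h_odd hm0 fun a ha b hb => ?_
    obtain ⟨p, q, rfl⟩ := h.exists_coords h_even ha
    obtain ⟨p', q', rfl⟩ := h.exists_coords h_even hb
    simp [hxx, hyy, hxy0, hyx0]
  · push Not at hsq
    obtain ⟨a, ha, haa⟩ := hsq
    have ha0 : a ≠ 0 := by
      rintro rfl
      simp at haa
    -- A nonzero even w with w² = κw and κ ≠ 0 would give the idempotent κ⁻¹w, which is excluded.
    have scale : ∀ {w : A} {κ : ℂ}, w ∈ 𝒜 0 → κ ≠ 0 → m w w = κ • w → w = 0 := by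
      intro w κ hw hκ hww
      by_contra hw0
      exact hu (κ⁻¹ • w) (Submodule.smul_mem _ _ hw) (smul_ne_zero (inv_ne_zero hκ) hw0)
        (by simp [hww, hκ])
    obtain ⟨b, hb⟩ : ∃ b, m a a = b := ⟨_, rfl⟩
    have hb𝒜 : b ∈ 𝒜 0 := hb ▸ hmul ha ha
    have hb0 : b ≠ 0 := hb ▸ haa
    have h : EvenPair 𝒜 a b := by
      refine ⟨ha, hb𝒜, fun p q hpq => ?_⟩
      have hq : q = 0 := by
        by_contra hq
        have hbκ : b = (-(q⁻¹ * p)) • a := by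
          have : q⁻¹ • (p • a + q • b) = 0 := by rw [hpq, smul_zero]
          rw [smul_add, smul_smul, smul_smul, inv_mul_cancel₀ hq, one_smul] at this
          rw [neg_smul]
          exact eq_neg_of_add_eq_zero_right this
        refine ha0 (scale ha (κ := -(q⁻¹ * p)) ?_ (hb.trans hbκ))
        intro h0
        rw [h0, zero_smul] at hbκ
        exact hb0 hbκ
      subst hq
      exact ⟨by simpa [ha0] using hpq, rfl⟩
    obtain ⟨α, β, hab⟩ := h.exists_coords h_even (hmul ha hb𝒜)
    have hba : m b a = α • a + β • b := by rw [← hab, ← hb, hm.assoc]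
    have hbb : m b b = (β * α) • a + (α + β * β) • b := by
      conv_lhs => rw [← hb, hm.assoc, hb, hab]
      simp only [map_add, map_smul, hb, hab]
      module
    by_cases hα : α = 0
    · subst hα
      by_cases hβ : β = 0
      · subst hβ
        exact exists_realizes_of_nilpotent hm h_even h_odd h hb (by simp [hab]) (by simp [hba])
          (by simp [hbb])
      · exact absurd (scale hb𝒜 (mul_self_ne_zero.2 hβ) (by simp [hbb])) hb0
    -- The element w = b - βa satisfies w² = αw, so w = 0, against the independence of a and b.
    · have hw : (-β) • a + (1 : ℂ) • b = 0 := by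
        refine scale (κ := α) (add_mem (Submodule.smul_mem _ _ ha) (Submodule.smul_mem _ _ hb𝒜))
          hα ?_
        simp only [map_add, map_smul, LinearMap.add_apply, LinearMap.smul_apply, hb, hab, hba, hbb]
        module
      exact absurd (h.indep _ _ hw).2 one_ne_zero

theorem exists_algIso_dTable {m : A →ₗ[ℂ] A →ₗ[ℂ] A} (hm : IsGradedAssoc 𝒜 m)
    (h_even : Module.finrank ℂ (𝒜 0) = 2) (h_odd : Module.finrank ℂ (𝒜 1) = 1) (hm0 : m ≠ 0)
    {v : Module.Basis (Fin 3) ℂ A} (hv : IsAdapted (parityRev 𝒜) v) :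
    ∃ n, AlgIso 𝒜 m (shift 𝒜 (dTable v n)) := by
  obtain ⟨n, v', hv', h⟩ := exists_realizes hm h_even h_odd hm0
  exact ⟨n, h.algIso hv' hv (hv.hasConstants_shift n)⟩

end Classification

end SuperAlg

/-! ### The main theorem: the algebra classification transported to codifferentials. -/

theorem mainTheorem1 {A : Type*} [AddCommGroup A] [Module ℂ A]
    (𝒜 : ZMod 2 → Submodule ℂ A) [DirectSum.Decomposition 𝒜]
    (h_even : Module.finrank ℂ (𝒜 0) = 2) (h_odd : Module.finrank ℂ (𝒜 1) = 1) :
    -- algebra structures on `A` are the same as odd quadratic codifferentials on `T(ΠA)`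
    (Set.BijOn (SuperAlg.codiffOfAlg 𝒜) {m | SuperAlg.IsGradedAssoc 𝒜 m}
        {D | SuperAlg.IsQuadCodiff (SuperAlg.parityRev 𝒜) D} ∧
      ∀ m m' : A →ₗ[ℂ] A →ₗ[ℂ] A,
        SuperAlg.IsGradedAssoc 𝒜 m → SuperAlg.IsGradedAssoc 𝒜 m' →
          (SuperAlg.AlgIso 𝒜 m m' ↔
            SuperAlg.CodiffEquiv (SuperAlg.parityRev 𝒜)
              (SuperAlg.codiffOfAlg 𝒜 m) (SuperAlg.codiffOfAlg 𝒜 m'))) ∧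
    (∃ v : Module.Basis (Fin 3) ℂ A, SuperAlg.IsAdapted (SuperAlg.parityRev 𝒜) v) ∧
    ∀ v : Module.Basis (Fin 3) ℂ A, SuperAlg.IsAdapted (SuperAlg.parityRev 𝒜) v →
      -- the classification of nonzero odd quadratic codifferentials
      ((∀ n : Fin 28,
          SuperAlg.IsQuadCodiff (SuperAlg.parityRev 𝒜)
            (SuperAlg.coder (SuperAlg.parityRev 𝒜) (SuperAlg.dTable v n)) ∧
          SuperAlg.coder (SuperAlg.parityRev 𝒜) (SuperAlg.dTable v n) ≠ 0) ∧
        (∀ n n' : Fin 28, n ≠ n' →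
          ¬ SuperAlg.CodiffEquiv (SuperAlg.parityRev 𝒜)
            (SuperAlg.coder (SuperAlg.parityRev 𝒜) (SuperAlg.dTable v n))
            (SuperAlg.coder (SuperAlg.parityRev 𝒜) (SuperAlg.dTable v n'))) ∧
        (∀ D : TensorAlgebra ℂ A →ₗ[ℂ] TensorAlgebra ℂ A,
          SuperAlg.IsQuadCodiff (SuperAlg.parityRev 𝒜) D → D ≠ 0 →
            ∃ n : Fin 28, SuperAlg.CodiffEquiv (SuperAlg.parityRev 𝒜) D
              (SuperAlg.coder (SuperAlg.parityRev 𝒜) (SuperAlg.dTable v n)))) ∧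
      -- the classification of nonzero graded associative algebra structures
      ((∀ n : Fin 28,
          SuperAlg.IsGradedAssoc 𝒜 (SuperAlg.shift 𝒜 (SuperAlg.dTable v n)) ∧
          SuperAlg.shift 𝒜 (SuperAlg.dTable v n) ≠ 0 ∧
          SuperAlg.codiffOfAlg 𝒜 (SuperAlg.shift 𝒜 (SuperAlg.dTable v n)) =
            SuperAlg.coder (SuperAlg.parityRev 𝒜) (SuperAlg.dTable v n)) ∧
        (∀ n n' : Fin 28, n ≠ n' →
          ¬ SuperAlg.AlgIso 𝒜 (SuperAlg.shift 𝒜 (SuperAlg.dTable v n))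
            (SuperAlg.shift 𝒜 (SuperAlg.dTable v n'))) ∧
        (∀ m : A →ₗ[ℂ] A →ₗ[ℂ] A, SuperAlg.IsGradedAssoc 𝒜 m → m ≠ 0 →
          ∃ n : Fin 28,
            SuperAlg.AlgIso 𝒜 m (SuperAlg.shift 𝒜 (SuperAlg.dTable v n)))) := by
  have hbij := SuperAlg.codiffOfAlg_bijOn 𝒜
  have hcoder : ∀ d, SuperAlg.codiffOfAlg 𝒜 (SuperAlg.shift 𝒜 d) =
      SuperAlg.coder (SuperAlg.parityRev 𝒜) d := fun d => by
    rw [SuperAlg.codiffOfAlg, SuperAlg.shift_shift]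
  have hinj : Function.Injective (SuperAlg.codiffOfAlg 𝒜) := fun m m' h => by
    rw [← SuperAlg.shift_shift 𝒜 m, SuperAlg.coder_injective _ h, SuperAlg.shift_shift]
  have hzero : SuperAlg.codiffOfAlg 𝒜 0 = 0 := by
    apply SuperAlg.tensor_hom_ext₂
    · simp [SuperAlg.codiffOfAlg, SuperAlg.coder_one]
    · simp [SuperAlg.codiffOfAlg, SuperAlg.coder_ι]
    · intro a b x h
      simp only [SuperAlg.codiffOfAlg] at h ⊢
      rw [SuperAlg.coder_ι_mul_ι_mul, h]
      simp
  refine ⟨⟨hbij, fun m m' _ _ => SuperAlg.algIso_iff_codiffEquiv 𝒜 m m'⟩, ?_, fun v hv => ?_⟩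
  · obtain ⟨x, y, h⟩ := SuperAlg.exists_evenPair h_even
    obtain ⟨e, he, he0⟩ := SuperAlg.exists_odd_ne_zero h_odd
    obtain ⟨v, hv, -⟩ := SuperAlg.exists_adapted h_even h_odd h he he0
    exact ⟨v, hv⟩
  refine ⟨⟨fun n => ⟨?_, ?_⟩, fun n n' hn => ?_, fun D hD hD0 => ?_⟩,
    fun n => ⟨SuperAlg.isGradedAssoc_dTable hv n, SuperAlg.shift_dTable_ne_zero hv n, hcoder _⟩,
    fun n n' hn => SuperAlg.not_algIso_dTable hv hn,
    fun m hm hm0 => SuperAlg.exists_algIso_dTable hm h_even h_odd hm0 hv⟩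
  · rw [← hcoder]
    exact hbij.mapsTo (SuperAlg.isGradedAssoc_dTable hv n)
  · rw [← hcoder, ← hzero]
    exact hinj.ne (SuperAlg.shift_dTable_ne_zero hv n)
  · rw [← hcoder, ← hcoder, ← SuperAlg.algIso_iff_codiffEquiv]
    exact SuperAlg.not_algIso_dTable hv hn
  · obtain ⟨m, hm, rfl⟩ := hbij.surjOn hD
    have hm0 : m ≠ 0 := by
      rintro rfl
      exact hD0 hzero
    obtain ⟨n, hn⟩ := SuperAlg.exists_algIso_dTable hm h_even h_odd hm0 hv
    exact ⟨n, by rwa [← hcoder, ← SuperAlg.algIso_iff_codiffEquiv]⟩
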